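/- Let $\mathbb K=\mathbb R$ or $\mathbb C$ and let $\mathbb P^n$ be the projective space of lines in $\mathbb K^{n+1}$, regarded as a real algebraic manifold. "Semialgebraic" is meant in the real sense and "smooth" means $C^1$ (over $\mathbb R$). A *stratification* of a semialgebraic set $X\subset\mathbb P^n$ is a partition of $X$ into nonempty smooth semialgebraic submanifolds of $\mathbb P^n$ (the strata), locally finite in $\mathbb P^n$ (hence finite). If $\mathcal S$ is a stratification of $X$ and $\mathcal T$ a stratification of a semialgebraic subset $Y\subset X$, then $(Y,\mathcal T)$ is a *substratified object* of $(X,\mathcal S)$ if each stratum of $\mathcal T$ is contained in a stratum of $\mathcal S$. Two substratified objects $(Z,\mathcal A)$, $(W,\mathcal B)$ of $(X,\mathcal S)$ are *transverse in* $(X,\mathcal S)$ if for all $S\in\mathcal S$, $A\in\mathcal A$, $B\in\mathcal B$ with $A,B\subset S$, the manifolds $A$ and $B$ are transverse in $S$: $T_xA+T_xB=T_xS$ for all $x\in A\cap B$. Let $\mathcal S$ be a stratification of $\mathbb P^n$, let $U\subset\mathbb K^{n+1}$ be open and semialgebraic, and let $\Psi:U\times\mathbb P^n\to\mathbb P^n$,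 $\Psi_t(x)=\Psi^x(t)=\Psi(t,x)$, be a semialgebraic stratified submersive family of diffeomorphisms; that is, for every stratum $S\in\mathcal S$ the map $\Psi$ restricts to a smooth map $U\times S\to S$ such that each $\Psi_t:S\to S$ is a diffeomorphism and, for all $(t,x)\in U\times S$, the differential of $\Psi^x:U\to S$ at $t$ is surjective onto $T_{\Psi(t,x)}S$. (For instance, $\mathcal S$ may be an algebraic stratification of $\mathbb P^n$ compatible with a given finite family of algebraic subsets, and $\Psi$ a semialgebraic stratified submersive family of diffeomorphisms parametrized by a neighborhood $U$ of the origin, with $\Psi_0=\mathrm{id}$, that is in addition an arc-wise analytic trivialization.) Let $Z$ and $W$ be semialgebraic subsets of $\mathbb P^n$ with stratifications $\mathcal A$ of $Z$ and $\mathcal B$ of $W$ such that $(Z,\mathcal A)$ and $(W,\mathcal B)$ are substratified objects of $(\mathbb P^n,\mathcal S)$. Then there is an open dense semialgebraic subset $U'$ of $U$ such that for all $t\in U'$ the pair $\Psi_t^{-1}(W,\mathcal B)=(\Psi_t^{-1}(W),\{\Psi_t^{-1}(B): B\in\mathcal B\})$ is a substratified object of $(\mathbb P^n,\mathcal S)$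 and $(Z,\mathcal A)$ is transverse to $\Psi_t^{-1}(W,\mathcal B)$ in $(\mathbb P^n,\mathcal S)$. -/

import Mathlib

open Set Filter Topology

noncomputable section

/-! ### Semialgebraic sets, submanifolds and tangent spaces in a real vector space -/

section Euclidean

variable {E : Type*} [NormedAddCommGroup E] [NormedSpace ℝ E]

/-- The real polynomial functions on `E`: the algebra of functions generated by the
linear forms. -/
def realPolyFunctions (E : Type*) [NormedAddCommGroup E] [NormedSpace ℝ E] :
    Subalgebra ℝ (E → ℝ) :=
  Algebra.adjoin ℝ (Set.range fun (l : E →ₗ[ℝ] ℝ) => (l : E → ℝ))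

/-- The semialgebraic subsets of `E`: the smallest Boolean algebra of subsets containing all
`{p > 0}` with `p` a polynomial function. -/
inductive IsSemialgebraic : Set E → Prop
  | pos (p : E → ℝ) (hp : p ∈ realPolyFunctions E) : IsSemialgebraic {x | 0 < p x}
  | compl (s : Set E) (hs : IsSemialgebraic s) : IsSemialgebraic sᶜ
  | union (s t : Set E) (hs : IsSemialgebraic s) (ht : IsSemialgebraic t) :
      IsSemialgebraic (s ∪ t)

/-- `M` is an (embedded) `C¹` submanifold of `E` of some dimension `d`: near each of its
points it is the zero set of a `C¹` map to `ℝᵏ`, `k = dim E - d`, with surjective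
differential. -/
def IsC1Submanifold (M : Set E) : Prop :=
  ∃ d k : ℕ, d + k = Module.finrank ℝ E ∧
    ∀ p ∈ M, ∃ f : E → (Fin k → ℝ),
      ContDiffAt ℝ 1 f p ∧ Function.Surjective (fderiv ℝ f p) ∧
        ∀ᶠ q in 𝓝 p, (q ∈ M ↔ f q = 0)

/-- The tangent space of `M` at `p`: the velocities at `p` of curves in `M`. -/
def tangentVectors (M : Set E) (p : E) : Set E :=
  {v | ∃ γ : ℝ → E, γ 0 = p ∧ HasDerivAt γ v 0 ∧ ∀ᶠ s in 𝓝 (0 : ℝ), γ s ∈ M}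

end Euclidean

/-! ### Projective space as a real algebraic set -/

/-- The projective space `ℙⁿ` over `𝕜` (`𝕜 = ℝ` or `ℂ`). -/
abbrev ProjSpace (𝕜 : Type*) [RCLike 𝕜] (n : ℕ) : Type _ :=
  Projectivization 𝕜 (Fin (n + 1) → 𝕜)

/-- The real vector space of `(n+1) × (n+1)` matrices over `𝕜`. -/
abbrev MatSpace (𝕜 : Type*) [RCLike 𝕜] (n : ℕ) : Type _ :=
  Fin (n + 1) → Fin (n + 1) → 𝕜

section Projective

variable {𝕜 : Type*} [RCLike 𝕜] {n : ℕ}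

/-- The matrix `v v* / |v|²` of the orthogonal projection onto the line spanned by `v`. -/
def lineMatrix (v : Fin (n + 1) → 𝕜) : MatSpace 𝕜 n :=
  fun i j => v i * (starRingEnd 𝕜) (v j) / (((∑ k, ‖v k‖ ^ 2 : ℝ)) : 𝕜)

theorem sum_norm_sq_pos {v : Fin (n + 1) → 𝕜} (hv : v ≠ 0) : 0 < ∑ k, ‖v k‖ ^ 2 := by
  obtain ⟨k, hk⟩ := Function.ne_iff.1 hv
  exact Finset.sum_pos' (fun _ _ => by positivity)
    ⟨k, Finset.mem_univ k, by have := norm_pos_iff.2 hk; positivity⟩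

theorem lineMatrix_smul (a : 𝕜) (ha : a ≠ 0) (v : Fin (n + 1) → 𝕜) :
    lineMatrix (a • v) = lineMatrix v := by
  funext i j
  have h : ((∑ k, ‖(a • v) k‖ ^ 2 : ℝ) : 𝕜)
      = (a * (starRingEnd 𝕜) a) * ((∑ k, ‖v k‖ ^ 2 : ℝ) : 𝕜) := by
    rw [RCLike.mul_conj]
    simp only [Pi.smul_apply, smul_eq_mul, norm_mul, mul_pow, ← Finset.mul_sum]
    push_cast
    rfl
  have ha' : a * (starRingEnd 𝕜) a ≠ 0 := mul_ne_zero ha (by simpa using ha)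
  unfold lineMatrix
  rw [h, ← mul_div_mul_left (v i * (starRingEnd 𝕜) (v j)) _ ha']
  simp only [Pi.smul_apply, smul_eq_mul, map_mul]
  ring

/-- The standard embedding of `ℙⁿ` as a compact nonsingular real algebraic set: a line is sent
to the matrix of the orthogonal projection onto it. It is a real analytic, semialgebraic
diffeomorphism from `ℙⁿ` onto the set of Hermitian idempotent matrices of trace one. The real
algebraic and differentiable structure of `ℙⁿ` (semialgebraic subsets, submanifolds, tangent
spaces, `C¹` maps) is expressed through it. -/
def projEmb (x : ProjSpace 𝕜 n) : MatSpace 𝕜 n :=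
  Projectivization.lift (fun v : {v : Fin (n + 1) → 𝕜 // v ≠ 0} => lineMatrix v.1)
    (by
      rintro ⟨v, hv⟩ ⟨w, hw⟩ t h
      have ht : t ≠ 0 := by
        rintro rfl
        exact hv (by simpa using h)
      simp only at h
      simp only [h]
      exact lineMatrix_smul t ht w) x

theorem projEmb_mk (v : Fin (n + 1) → 𝕜) (hv : v ≠ 0) :
    projEmb (Projectivization.mk 𝕜 v hv) = lineMatrix v := rfl

theorem projEmb_injective : Function.Injective (projEmb : ProjSpace 𝕜 n → MatSpace 𝕜 n) := by
  intro x y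
  induction x using Projectivization.ind with
  | h v hv =>
  induction y using Projectivization.ind with
  | h w hw =>
  intro h
  rw [projEmb_mk, projEmb_mk] at h
  rw [Projectivization.mk_eq_mk_iff']
  obtain ⟨j, hj⟩ := Function.ne_iff.1 hv
  have hv0 : ((∑ k, ‖v k‖ ^ 2 : ℝ) : 𝕜) ≠ 0 := by exact_mod_cast (sum_norm_sq_pos hv).ne'
  have hj' : (starRingEnd 𝕜) (v j) ≠ 0 := by simpa using hj
  refine ⟨((starRingEnd 𝕜) (w j) / ((∑ k, ‖w k‖ ^ 2 : ℝ) : 𝕜)) *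
    (((∑ k, ‖v k‖ ^ 2 : ℝ) : 𝕜) / (starRingEnd 𝕜) (v j)), ?_⟩
  funext i
  have hij : v i * (starRingEnd 𝕜) (v j) / ((∑ k, ‖v k‖ ^ 2 : ℝ) : 𝕜)
      = w i * (starRingEnd 𝕜) (w j) / ((∑ k, ‖w k‖ ^ 2 : ℝ) : 𝕜) := congrFun (congrFun h i) j
  rw [div_eq_iff hv0] at hij
  have : v i = w i * (starRingEnd 𝕜) (w j) / ((∑ k, ‖w k‖ ^ 2 : ℝ) : 𝕜)
      * ((∑ k, ‖v k‖ ^ 2 : ℝ) : 𝕜) / (starRingEnd 𝕜) (v j) := by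
    rw [← hij, mul_div_assoc, div_self hj', mul_one]
  rw [this, Pi.smul_apply, smul_eq_mul]
  ring

/-- The tangent space at `x` of a submanifold `M` of `ℙⁿ`. -/
def tangentAt (M : Set (ProjSpace 𝕜 n)) (x : ProjSpace 𝕜 n) : Set (MatSpace 𝕜 n) :=
  tangentVectors (projEmb '' M) (projEmb x)

/-! ### Stratifications of subsets of projective space -/

/-- `𝒮` is a stratification of the semialgebraic set `X ⊆ ℙⁿ`: a partition of `X` into
semialgebraic `C¹` submanifolds, locally finite in `ℙⁿ` (equivalently, as the image of
`projEmb` is compact, locally finite in the space of matrices). -/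
structure IsStratification (𝒮 : Set (Set (ProjSpace 𝕜 n))) (X : Set (ProjSpace 𝕜 n)) :
    Prop where
  semialgebraic : IsSemialgebraic (projEmb '' X)
  nonempty : ∀ S ∈ 𝒮, S.Nonempty
  disjoint : 𝒮.PairwiseDisjoint id
  sUnion_eq : ⋃₀ 𝒮 = X
  locallyFinite : LocallyFinite fun S : 𝒮 => projEmb '' (S : Set (ProjSpace 𝕜 n))
  stratum_semialgebraic : ∀ S ∈ 𝒮, IsSemialgebraic (projEmb '' S)
  stratum_submanifold : ∀ S ∈ 𝒮, IsC1Submanifold (projEmb '' S)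

/-- `(Y, 𝒯)` is a substratified object of `(X, 𝒮)`. -/
structure IsSubstratified (X : Set (ProjSpace 𝕜 n)) (𝒮 : Set (Set (ProjSpace 𝕜 n)))
    (Y : Set (ProjSpace 𝕜 n)) (𝒯 : Set (Set (ProjSpace 𝕜 n))) : Prop where
  subset : Y ⊆ X
  stratification : IsStratification 𝒯 Y
  exists_stratum : ∀ T ∈ 𝒯, ∃ S ∈ 𝒮, T ⊆ S

/-- The submanifolds `A`, `B` of `S` are transverse in `S`. -/
def TransverseIn (S A B : Set (ProjSpace 𝕜 n)) : Prop :=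
  ∀ x ∈ A ∩ B, {w | ∃ u ∈ tangentAt A x, ∃ v ∈ tangentAt B x, u + v = w} = tangentAt S x

/-- The substratified objects `(Z, 𝒜)` and `(W, ℬ)` of `(X, 𝒮)` are transverse in `(X, 𝒮)`. -/
structure StratifiedTransverse (X : Set (ProjSpace 𝕜 n)) (𝒮 : Set (Set (ProjSpace 𝕜 n)))
    (Z : Set (ProjSpace 𝕜 n)) (𝒜 : Set (Set (ProjSpace 𝕜 n)))
    (W : Set (ProjSpace 𝕜 n)) (ℬ : Set (Set (ProjSpace 𝕜 n))) : Prop where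
  left : IsSubstratified X 𝒮 Z 𝒜
  right : IsSubstratified X 𝒮 W ℬ
  transverse : ∀ S ∈ 𝒮, ∀ A ∈ 𝒜, ∀ B ∈ ℬ, A ⊆ S → B ⊆ S → TransverseIn S A B

/-! ### Stratified submersive families of diffeomorphisms -/

/-- `Ψ` restricts to a submersive family of diffeomorphisms `U × S → S`, where `U` is open in
`𝕜ᵐ` and `S` is a submanifold of `ℙⁿ`. (On a submanifold, `ContDiffOn ℝ 1` is the usual notion
of a `C¹` map.) -/
structure IsSubmersiveFamily {m : ℕ} (U : Set (Fin m → 𝕜)) (S : Set (ProjSpace 𝕜 n))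
    (Ψ : (Fin m → 𝕜) → ProjSpace 𝕜 n → ProjSpace 𝕜 n) : Prop where
  /-- `Ψ : U × S → S` is `C¹`. -/
  smooth : ∃ F : (Fin m → 𝕜) × MatSpace 𝕜 n → MatSpace 𝕜 n,
    ContDiffOn ℝ 1 F (U ×ˢ (projEmb '' S)) ∧
      ∀ t ∈ U, ∀ x ∈ S, F (t, projEmb x) = projEmb (Ψ t x)
  /-- Each `Ψ_t : S → S` is bijective, -/
  bijOn : ∀ t ∈ U, BijOn (Ψ t) S S
  /-- with `C¹` inverse. -/
  smooth_inv : ∀ t ∈ U, ∃ G : MatSpace 𝕜 n → MatSpace 𝕜 n,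
    ContDiffOn ℝ 1 G (projEmb '' S) ∧ ∀ x ∈ S, G (projEmb (Ψ t x)) = projEmb x
  /-- The differential of `Ψ^x : U → S` at each `t` is onto the tangent space of `S`. -/
  submersive : ∀ t ∈ U, ∀ x ∈ S,
    Set.range (fderiv ℝ (fun s => projEmb (Ψ s x)) t) = tangentAt S (Ψ t x)

/-- `Ψ` is a stratified submersive family of diffeomorphisms: it preserves each stratum of `𝒮` and
restricts on it to a submersive family of diffeomorphisms. -/
def IsStratifiedSubmersiveFamily {m : ℕ} (U : Set (Fin m → 𝕜))
    (𝒮 : Set (Set (ProjSpace 𝕜 n)))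
    (Ψ : (Fin m → 𝕜) → ProjSpace 𝕜 n → ProjSpace 𝕜 n) : Prop :=
  ∀ S ∈ 𝒮, IsSubmersiveFamily U S Ψ

/-- `Ψ : U × ℙⁿ → ℙⁿ` is semialgebraic: its graph is a semialgebraic set. -/
def IsSemialgebraicFamily {m : ℕ} (U : Set (Fin m → 𝕜))
    (Ψ : (Fin m → 𝕜) → ProjSpace 𝕜 n → ProjSpace 𝕜 n) : Prop :=
  IsSemialgebraic {q : (Fin m → 𝕜) × MatSpace 𝕜 n × MatSpace 𝕜 n |
    q.1 ∈ U ∧ ∃ x, q.2.1 = projEmb x ∧ q.2.2 = projEmb (Ψ q.1 x)}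

end Projective

end

/-!
Fix strata `A`, `B` contained in a stratum `S`. Tangent vectors of a submanifold are limits of
secants, a first-order condition, so by Tarski–Seidenberg the pairs `(t, x)` such that `Ψ_t⁻¹(B)`
fails to be transverse to `A` at `x` form a semialgebraic set, and so do the parameters `t` that
occur in such a pair. A semialgebraic set without interior is contained in the zero set of a
nonzero polynomial; finitely many strata give finitely many polynomials, and `U'` is the set of
parameters in `U` at which their product does not vanish. If the bad parameters had interior, there
would be a differentiable map `σ` on a nonempty open set such that `(t, σ t)` is always a bad pair.
Then `Ψ (t, σ t) ∈ B` for all `t`. Differentiating this, and using that `Ψ^x` is a submersion, one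
sees that `A` and `Ψ_t⁻¹(B)` are transverse at `σ t` after all.

Tarski–Seidenberg is proved for one variable `r` at a time: the way in which finitely many
polynomials in `r` and their derivatives divide up the line depends, up to an order isomorphism,
only on the signs of finitely many expressions in their coefficients. Differentiable sections come
from the implicit function theorem: each coordinate is a root of a polynomial, and where the
polynomial has a multiple root one passes to its derivatives; by Baire's theorem one of the
finitely many resulting cases occurs on an open set.
-/

/-! ### Roots and signs of real polynomials -/

section OrderIso

open SignType (sign)

theorem exists_orderIso_apply_eq_of_le {a b c d : ℝ} (hc : c ∈ Ioo a b) (hd : d ∈ Ioo a b)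
    (hcd : c ≤ d) : ∃ ψ : ℝ ≃o ℝ, ψ c = d ∧ ∀ x ∉ Ioo a b, ψ x = x := by
  obtain ⟨hac, hcb⟩ := hc
  obtain ⟨had, hdb⟩ := hd
  have hl : 0 < (d - a) / (c - a) := div_pos (sub_pos.2 had) (sub_pos.2 hac)
  have hr : 0 < (b - d) / (b - c) := div_pos (sub_pos.2 hdb) (sub_pos.2 hcb)
  have hl' : 1 ≤ (d - a) / (c - a) := (one_le_div (sub_pos.2 hac)).2 (by linarith)
  have hr' : (b - d) / (b - c) ≤ 1 := (div_le_one (sub_pos.2 hcb)).2 (by linarith)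
  have hla : d - a = (c - a) * ((d - a) / (c - a)) := (mul_div_cancel₀ _ (sub_pos.2 hac).ne').symm
  have hrb : b - d = (b - c) * ((b - d) / (b - c)) := (mul_div_cancel₀ _ (sub_pos.2 hcb).ne').symm
  set l := (d - a) / (c - a)
  set r := (b - d) / (b - c)
  -- The graph is the diagonal outside `Ioo a b`, bent to pass through `(c, d)` inside.
  set f : ℝ → ℝ := fun x => max x (min (d + (x - c) * l) (d + (x - c) * r)) with hf
  have hfix : ∀ x ∉ Ioo a b, f x = x := fun x hx => by
    refine max_eq_left (min_le_iff.2 ?_)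
    rcases le_or_gt x a with hxa | hxa
    · left; nlinarith
    · right; nlinarith [not_lt.1 fun h => hx ⟨hxa, h⟩]
  have hmono : StrictMono f := fun x y hxy => by
    have hleft : d + (x - c) * l < d + (y - c) * l := by gcongr
    have hright : d + (x - c) * r < d + (y - c) * r := by gcongr
    exact max_lt_max hxy (min_lt_min hleft hright)
  have hsurj : Function.Surjective f := by
    refine Continuous.surjective (by fun_prop) (tendsto_id.congr' ?_) (tendsto_id.congr' ?_)
    · filter_upwards [eventually_ge_atTop b] with x hx using (hfix x fun h => h.2.not_ge hx).symm
    · filter_upwards [eventually_le_atBot a] with x hx using (hfix x fun h => h.1.not_ge hx).symm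
  exact ⟨hmono.orderIsoOfSurjective f hsurj, by simp [hf, hcd], hfix⟩

theorem exists_orderIso_apply_eq {a b c d : ℝ} (hc : c ∈ Ioo a b) (hd : d ∈ Ioo a b) :
    ∃ ψ : ℝ ≃o ℝ, ψ c = d ∧ ∀ x ∉ Ioo a b, ψ x = x := by
  rcases le_total c d with h | h
  · exact exists_orderIso_apply_eq_of_le hc hd h
  · obtain ⟨ψ, hψ, hfix⟩ := exists_orderIso_apply_eq_of_le hd hc h
    exact ⟨ψ.symm, by rw [← hψ, ψ.symm_apply_apply],
      fun x hx => by rw [ψ.symm_apply_eq, hfix x hx]⟩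

variable {f g : ℝ → ℝ} {a b : ℝ}

theorem exists_orderIso_sign_eq_of_strictMonoOn (hab : a ≤ b)
    (hf : StrictMonoOn f (Icc a b)) (hg : StrictMonoOn g (Icc a b))
    (hfc : ContinuousOn f (Icc a b)) (hgc : ContinuousOn g (Icc a b))
    (ha : sign (f a) = sign (g a)) (hb : sign (f b) = sign (g b)) :
    ∃ ψ : ℝ ≃o ℝ, (∀ x ∉ Ioo a b, ψ x = x) ∧
      ∀ x ∈ Icc a b, sign (f x) = sign (g (ψ x)) := by
  have hal : a ∈ Icc a b := left_mem_Icc.2 hab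
  have hbr : b ∈ Icc a b := right_mem_Icc.2 hab
  rcases le_or_gt 0 (f a) with hfa | hfa
  · refine ⟨OrderIso.refl ℝ, fun _ _ => rfl, fun x hx => ?_⟩
    rcases hx.1.eq_or_lt with rfl | hax
    · exact ha
    have hga : 0 ≤ g a := by rwa [← sign_nonneg_iff, ← ha, sign_nonneg_iff]
    rw [OrderIso.refl_apply, sign_pos (hfa.trans_lt (hf hal hx hax)),
      sign_pos (hga.trans_lt (hg hal hx hax))]
  rcases le_or_gt (f b) 0 with hfb | hfb
  · refine ⟨OrderIso.refl ℝ, fun _ _ => rfl, fun x hx => ?_⟩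
    rcases hx.2.eq_or_lt with rfl | hxb
    · exact hb
    have hgb : g b ≤ 0 := by rwa [← sign_nonpos_iff, ← hb, sign_nonpos_iff]
    rw [OrderIso.refl_apply, sign_neg ((hf hx hbr hxb).trans_le hfb),
      sign_neg ((hg hx hbr hxb).trans_le hgb)]
  have hga : g a < 0 := by rwa [← sign_eq_neg_one_iff, ← ha, sign_eq_neg_one_iff]
  have hgb : 0 < g b := by rwa [← sign_eq_one_iff, ← hb, sign_eq_one_iff]
  obtain ⟨c, hc, hfc0⟩ := intermediate_value_Ioo hab hfc ⟨hfa, hfb⟩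
  obtain ⟨d, hd, hgd0⟩ := intermediate_value_Ioo hab hgc ⟨hga, hgb⟩
  obtain ⟨ψ, hψ, hfix⟩ := exists_orderIso_apply_eq hc hd
  refine ⟨ψ, hfix, fun x hx => ?_⟩
  have hψx : ψ x ∈ Icc a b := by
    rw [← hfix a left_notMem_Ioo, ← hfix b right_notMem_Ioo]
    exact ⟨ψ.monotone hx.1, ψ.monotone hx.2⟩
  have hc' := Ioo_subset_Icc_self hc
  have hd' := Ioo_subset_Icc_self hd
  rcases lt_trichotomy x c with h | rfl | h
  · have h' : ψ x < d := hψ ▸ ψ.strictMono h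
    rw [sign_neg (hfc0 ▸ hf hx hc' h), sign_neg (hgd0 ▸ hg hψx hd' h')]
  · rw [hψ, hfc0, hgd0]
  · have h' : d < ψ x := hψ ▸ ψ.strictMono h
    rw [sign_pos (hfc0 ▸ hf hc' hx h), sign_pos (hgd0 ▸ hg hd' hψx h')]

theorem exists_orderIso_sign_eq_of_strictAntiOn (hab : a ≤ b)
    (hf : StrictAntiOn f (Icc a b)) (hg : StrictAntiOn g (Icc a b))
    (hfc : ContinuousOn f (Icc a b)) (hgc : ContinuousOn g (Icc a b))
    (ha : sign (f a) = sign (g a)) (hb : sign (f b) = sign (g b)) :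
    ∃ ψ : ℝ ≃o ℝ, (∀ x ∉ Ioo a b, ψ x = x) ∧
      ∀ x ∈ Icc a b, sign (f x) = sign (g (ψ x)) := by
  simpa only [Left.sign_neg, neg_inj] using
    exists_orderIso_sign_eq_of_strictMonoOn hab (f := fun x => -f x) (g := fun x => -g x)
      (fun x hx y hy h => neg_lt_neg (hf hx hy h)) (fun x hx y hy h => neg_lt_neg (hg hx hy h))
      hfc.neg hgc.neg (by simpa only [Left.sign_neg, neg_inj] using ha)
      (by simpa only [Left.sign_neg, neg_inj] using hb)

theorem exists_orderIso_sign_eq_between (hf : Continuous f) (hg : Continuous g) (M : Finset ℝ)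
    (hM : ∀ x ∈ M, sign (f x) = sign (g x))
    (hmono : ∀ u ∈ M, ∀ v ∈ M, u < v → (∀ m ∈ M, m ∉ Ioo u v) →
      StrictMonoOn f (Icc u v) ∧ StrictMonoOn g (Icc u v) ∨
        StrictAntiOn f (Icc u v) ∧ StrictAntiOn g (Icc u v)) :
    ∃ ψ : ℝ ≃o ℝ, (∀ x, (∀ m ∈ M, m ≤ x) → ψ x = x) ∧ (∀ m ∈ M, ψ m = m) ∧
      ∀ u ∈ M, ∀ v ∈ M, ∀ x ∈ Icc u v, sign (f x) = sign (g (ψ x)) := by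
  induction M using Finset.induction_on_max with
  | empty => exact ⟨OrderIso.refl ℝ, by simp⟩
  | insert b M hb ih =>
    simp only [Finset.forall_mem_insert] at hM hmono ⊢
    rcases M.eq_empty_or_nonempty with rfl | hne
    · exact ⟨OrderIso.refl ℝ, by simp, by simp, by simp [hM.1], by simp⟩
    obtain ⟨ψ, hfix, hψM, hψ⟩ := ih hM.2 fun u hu v hv huv hdisj =>
      (hmono.2 u hu).2 v hv huv ⟨fun h => (hb v hv).not_gt h.2, hdisj⟩
    set a := M.max' hne
    have haM : a ∈ M := M.max'_mem hne
    have hle : ∀ m ∈ M, m ≤ a := M.le_max'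
    have hab : a < b := hb a haM
    obtain ⟨χ, hχfix, hχ⟩ : ∃ χ : ℝ ≃o ℝ, (∀ x ∉ Ioo a b, χ x = x) ∧
        ∀ x ∈ Icc a b, sign (f x) = sign (g (χ x)) := by
      rcases (hmono.2 a haM).1 hab ⟨right_notMem_Ioo, fun m hm h => (hle m hm).not_gt h.1⟩ with
        h | h
      · exact exists_orderIso_sign_eq_of_strictMonoOn hab.le h.1 h.2 hf.continuousOn
          hg.continuousOn (hM.2 a haM) hM.1
      · exact exists_orderIso_sign_eq_of_strictAntiOn hab.le h.1 h.2 hf.continuousOn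
          hg.continuousOn (hM.2 a haM) hM.1
    have hbelow : ∀ x ≤ a, χ (ψ x) = ψ x := fun x hx =>
      hχfix _ fun h => h.1.not_ge (hψM a haM ▸ ψ.monotone hx)
    have habove : ∀ x, a ≤ x → ψ x = x := fun x hx => hfix x fun m hm => (hle m hm).trans hx
    have hsign : ∀ u ∈ M, ∀ x ∈ Icc u b, sign (f x) = sign (g (χ (ψ x))) := fun u hu x hx => by
      rcases le_total x a with hxa | hax
      · rw [hbelow x hxa, hψ u hu a haM x ⟨hx.1, hxa⟩]
      · rw [habove x hax, hχ x ⟨hax, hx.2⟩]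
    refine ⟨ψ.trans χ, fun x hx => ?_, ⟨?_, fun m hm => ?_⟩, ⟨?_, fun v hv x hx => ?_⟩,
      fun u hu => ⟨hsign u hu, fun v hv x hx => hsign u hu x ⟨hx.1, hx.2.trans (hb v hv).le⟩⟩⟩
    · have hbx : b ≤ x := hx.1
      rw [OrderIso.trans_apply, habove x (hab.le.trans hbx), hχfix x fun h => h.2.not_ge hbx]
    · rw [OrderIso.trans_apply, habove b hab.le, hχfix b right_notMem_Ioo]
    · rw [OrderIso.trans_apply, hbelow m (hle m hm), hψM m hm]
    · intro x hx
      rw [le_antisymm hx.2 hx.1]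
      exact hsign a haM b ⟨hab.le, le_rfl⟩
    · exact absurd (hx.1.trans hx.2) (hb v hv).not_ge

theorem exists_orderIso_sign_eq (hf : Continuous f) (hg : Continuous g) {M : Set ℝ}
    (hMfin : M.Finite) (hM : ∀ x ∈ M, sign (f x) = sign (g x))
    (hmono : ∀ u v, (∀ m ∈ M, m ∉ Ioo u v) →
      StrictMonoOn f (Icc u v) ∧ StrictMonoOn g (Icc u v) ∨
        StrictAntiOn f (Icc u v) ∧ StrictAntiOn g (Icc u v))
    (hbot : ∃ s, ∀ᶠ x in atBot, sign (f x) = s ∧ sign (g x) = s)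
    (htop : ∃ s, ∀ᶠ x in atTop, sign (f x) = s ∧ sign (g x) = s) :
    ∃ ψ : ℝ ≃o ℝ, (∀ m ∈ M, ψ m = m) ∧ ∀ x, sign (f x) = sign (g (ψ x)) := by
  obtain ⟨s, hs⟩ := hbot
  obtain ⟨s', hs'⟩ := htop
  obtain ⟨A, hA⟩ := eventually_atBot.1 hs
  obtain ⟨B, hB⟩ := eventually_atTop.1 hs'
  classical
  obtain ⟨ψ, -, hψM, hψ⟩ := exists_orderIso_sign_eq_between hf hg
    (insert A (insert B hMfin.toFinset))
    (by
      simp only [Finset.forall_mem_insert, Finite.mem_toFinset]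
      exact ⟨(hA A le_rfl).1.trans (hA A le_rfl).2.symm,
        (hB B le_rfl).1.trans (hB B le_rfl).2.symm, hM⟩)
    (fun u _ v _ _ h => hmono u v fun m hm => h m (by simp [hm]))
  simp only [Finset.forall_mem_insert, Finite.mem_toFinset] at hψM hψ
  refine ⟨ψ, hψM.2.2, fun x => ?_⟩
  rcases le_total x A with hx | hAx
  · rw [(hA x hx).1, (hA (ψ x) (hψM.1 ▸ ψ.monotone hx)).2]
  rcases le_total B x with hx | hxB
  · rw [(hB x hx).1, (hB (ψ x) (hψM.2.1 ▸ ψ.monotone hx)).2]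
  exact hψ.1.2.1 x ⟨hAx, hxB⟩

end OrderIso

section Univariate

open Polynomial
open SignType (sign)

theorem exists_isRoot_mem_uIcc {p : ℝ[X]} {x y : ℝ} (hxy : sign (p.eval x) ≠ sign (p.eval y)) :
    ∃ z ∈ uIcc x y, p.IsRoot z := by
  by_contra! h
  have hx := h x left_mem_uIcc
  have hy := h y right_mem_uIcc
  have hivt := intermediate_value_uIcc (a := x) (b := y) p.continuous.continuousOn
  have hzero : (0 : ℝ) ∉ uIcc (p.eval x) (p.eval y) := fun h0 => by
    obtain ⟨z, hz, hz0⟩ := hivt h0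
    exact h z hz hz0
  rw [mem_uIcc, not_or] at hzero
  rcases lt_or_gt_of_ne hx with h1 | h1 <;> rcases lt_or_gt_of_ne hy with h2 | h2
  · exact hxy (by rw [sign_neg h1, sign_neg h2])
  · exact hzero.1 ⟨h1.le, h2.le⟩
  · exact hzero.2 ⟨h2.le, h1.le⟩
  · exact hxy (by rw [sign_pos h1, sign_pos h2])

theorem sign_eval_orderIso_eq {p : ℝ[X]} {ψ : ℝ ≃o ℝ} (hψ : ∀ z, p.IsRoot z → ψ z = z) (x : ℝ) :
    sign (p.eval (ψ x)) = sign (p.eval x) := by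
  by_contra hne
  obtain ⟨z, hz, hz0⟩ := exists_isRoot_mem_uIcc hne
  have hψz := hψ z hz0
  rcases mem_uIcc.1 hz with ⟨h1, h2⟩ | ⟨h1, h2⟩
  · have := ψ.le_iff_le.1 (h1.trans hψz.ge)
    rw [le_antisymm this h2, hψz] at hne
    exact hne rfl
  · have := ψ.le_iff_le.1 (hψz.le.trans h2)
    rw [le_antisymm h1 this, hψz] at hne
    exact hne rfl

theorem eventually_sign_eval_atTop (p : ℝ[X]) :
    ∀ᶠ z in atTop, sign (p.eval z) = sign p.leadingCoeff := by
  rcases Nat.eq_zero_or_pos p.natDegree with h | h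
  · obtain ⟨c, rfl⟩ := natDegree_eq_zero.1 h
    simp
  have hd : 0 < p.degree := natDegree_pos_iff_degree_pos.1 h
  rcases lt_trichotomy p.leadingCoeff 0 with h1 | h1 | h1
  · filter_upwards [(p.tendsto_atBot_of_leadingCoeff_nonpos hd h1.le).eventually_lt_atBot 0]
      with z hz
    rw [sign_neg h1, sign_neg hz]
  · simp [leadingCoeff_eq_zero.1 h1]
  · filter_upwards [(p.tendsto_atTop_of_leadingCoeff_nonneg hd h1.le).eventually_gt_atTop 0]
      with z hz
    rw [sign_pos h1, sign_pos hz]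

theorem eventually_sign_eval_atBot (p : ℝ[X]) :
    ∀ᶠ z in atBot, sign (p.eval z) = sign (p.leadingCoeff * (-1) ^ p.natDegree) := by
  have hlead : (p.comp (-X : ℝ[X])).leadingCoeff = p.leadingCoeff * (-1) ^ p.natDegree := by
    rw [leadingCoeff_comp (by simp)]; simp
  filter_upwards [tendsto_neg_atBot_atTop.eventually (eventually_sign_eval_atTop (p.comp (-X)))]
    with z hz
  simpa [hlead] using hz

theorem eval_pos_or_neg_on_Ioo {p : ℝ[X]} {a b : ℝ} (h : ∀ z ∈ Ioo a b, ¬p.IsRoot z) :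
    (∀ z ∈ Ioo a b, 0 < p.eval z) ∨ ∀ z ∈ Ioo a b, p.eval z < 0 := by
  by_contra! hne
  obtain ⟨⟨z, hz, hpz⟩, w, hw, hpw⟩ := hne
  obtain ⟨y, hy, hy0⟩ : ∃ y ∈ uIcc z w, p.IsRoot y := exists_isRoot_mem_uIcc (by
    rw [sign_neg (hpz.lt_of_ne (h z hz)), sign_pos (hpw.lt_of_ne' (h w hw))]
    decide)
  exact h y (ordConnected_Ioo.uIcc_subset hz hw hy) hy0

theorem strictMonoOn_Icc_eval {p : ℝ[X]} {a b : ℝ}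
    (h : ∀ z ∈ Ioo a b, 0 < p.derivative.eval z) : StrictMonoOn (fun x => p.eval x) (Icc a b) :=
  strictMonoOn_of_deriv_pos (convex_Icc a b) p.continuous.continuousOn fun z hz => by
    rw [p.deriv]; exact h z (interior_Icc (α := ℝ) ▸ hz)

theorem strictAntiOn_Icc_eval {p : ℝ[X]} {a b : ℝ}
    (h : ∀ z ∈ Ioo a b, p.derivative.eval z < 0) : StrictAntiOn (fun x => p.eval x) (Icc a b) :=
  strictAntiOn_of_deriv_neg (convex_Icc a b) p.continuous.continuousOn fun z hz => by
    rw [p.deriv]; exact h z (interior_Icc (α := ℝ) ▸ hz)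

theorem strictMonoOn_or_strictAntiOn_of_sign_derivative {p q : ℝ[X]} {φ : ℝ ≃o ℝ} {a b : ℝ}
    (hsign : ∀ x, sign (p.derivative.eval x) = sign (q.derivative.eval (φ x)))
    (hroot : ∀ x ∈ Ioo a b, ¬p.derivative.IsRoot x) :
    StrictMonoOn (fun x => p.eval x) (Icc a b) ∧
        StrictMonoOn (fun x => q.eval (φ x)) (Icc a b) ∨
      StrictAntiOn (fun x => p.eval x) (Icc a b) ∧
        StrictAntiOn (fun x => q.eval (φ x)) (Icc a b) := by
  have hsymm : ∀ y ∈ Ioo (φ a) (φ b), φ.symm y ∈ Ioo a b := fun y hy =>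
    ⟨φ.lt_symm_apply.2 hy.1, φ.symm_apply_lt.2 hy.2⟩
  have hsign' : ∀ y, sign (q.derivative.eval y) = sign (p.derivative.eval (φ.symm y)) :=
    fun y => by rw [hsign, φ.apply_symm_apply]
  have hmaps : MapsTo φ (Icc a b) (Icc (φ a) (φ b)) := fun x hx =>
    ⟨φ.monotone hx.1, φ.monotone hx.2⟩
  refine (eval_pos_or_neg_on_Ioo hroot).imp (fun h => ⟨strictMonoOn_Icc_eval h, ?_⟩)
    fun h => ⟨strictAntiOn_Icc_eval h, ?_⟩
  · refine (strictMonoOn_Icc_eval fun y hy => ?_).comp (φ.strictMono.strictMonoOn _) hmaps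
    rw [← sign_eq_one_iff, hsign', sign_eq_one_iff]
    exact h _ (hsymm y hy)
  · refine (strictAntiOn_Icc_eval fun y hy => ?_).comp_strictMonoOn
      (φ.strictMono.strictMonoOn _) hmaps
    rw [← sign_eq_neg_one_iff, hsign', sign_eq_neg_one_iff]
    exact h _ (hsymm y hy)

theorem exists_orderIso_sign_eval_eq {p q : ℝ[X]} {φ : ℝ ≃o ℝ} {M : Set ℝ} (hM : M.Finite)
    (hMsign : ∀ x ∈ M, sign (p.eval x) = sign (q.eval (φ x)))
    (hcrit : ∀ x, p.derivative.IsRoot x → x ∈ M)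
    (hder : ∀ x, sign (p.derivative.eval x) = sign (q.derivative.eval (φ x)))
    (hlead : sign p.leadingCoeff = sign q.leadingCoeff) (hdeg : p.natDegree = q.natDegree) :
    ∃ ψ : ℝ ≃o ℝ, (∀ x ∈ M, ψ x = x) ∧ ∀ x, sign (p.eval x) = sign (q.eval (φ (ψ x))) := by
  refine exists_orderIso_sign_eq p.continuous (q.continuous.comp φ.continuous) hM hMsign
    (fun u v huv => strictMonoOn_or_strictAntiOn_of_sign_derivative hder
      fun x hx h0 => huv x (hcrit x h0) hx)
    ⟨sign (p.leadingCoeff * (-1) ^ p.natDegree), ?_⟩ ⟨sign p.leadingCoeff, ?_⟩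
  · refine (eventually_sign_eval_atBot p).and ?_
    rw [sign_mul, hlead, hdeg, ← sign_mul]
    exact φ.tendsto_atBot.eventually (eventually_sign_eval_atBot q)
  · refine (eventually_sign_eval_atTop p).and ?_
    rw [hlead]
    exact φ.tendsto_atTop.eventually (eventually_sign_eval_atTop q)

end Univariate

section SignDetermined

open Polynomial
open SignType (sign)

variable {R : Type*} [CommRing R]

theorem exists_leadingCoeff_pow_mul_eq (P Q : R[X]) (hQ : 0 < Q.natDegree) :
    ∃ (g A : R[X]) (k : ℕ), g.natDegree < Q.natDegree ∧
      C Q.leadingCoeff ^ k * P = Q * A + g := by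
  induction h : P.natDegree using Nat.strong_induction_on generalizing P with
  | _ n ih =>
    subst h
    by_cases hPQ : P.natDegree < Q.natDegree
    · exact ⟨P, 0, 0, hPQ, by simp⟩
    push Not at hPQ
    obtain ⟨g, A, k, hg, hA⟩ := ih _
      (natDegree_cancelLeads_lt_of_natDegree_le_natDegree hPQ (hQ.trans_le hPQ))
      (Q.cancelLeads P) rfl
    refine ⟨g, A + C Q.leadingCoeff ^ k * (C P.leadingCoeff *
      X ^ (P.natDegree - Q.natDegree)), k + 1, hg, ?_⟩
    have hcancel : C Q.leadingCoeff * P =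
        Q.cancelLeads P + C P.leadingCoeff * X ^ (P.natDegree - Q.natDegree) * Q := by
      rw [cancelLeads, Nat.sub_eq_zero_of_le hPQ, pow_zero, mul_one, sub_add_cancel]
    rw [pow_succ, mul_assoc, hcancel, mul_add, hA]
    ring

theorem sign_eval_of_pow_mul_eq {P Q g A : R[X]} {c : R} {k : ℕ} (h : C c ^ k * P = Q * A + g)
    (t : R →+* ℝ) {x : ℝ} (hx : (Q.map t).IsRoot x) :
    sign (t c) ^ k * sign ((P.map t).eval x) = sign ((g.map t).eval x) := by
  have := congrArg (fun f => (f.map t).eval x) h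
  simp only [Polynomial.map_mul, Polynomial.map_add, Polynomial.map_pow, eval_mul, eval_add,
    eval_pow, map_C, eval_C, hx.eq_zero, zero_mul, zero_add] at this
  rw [← this, sign_mul, sign_pow]

theorem map_eraseLead_of_map_leadingCoeff_eq_zero {S : Type*} [CommRing S] {Q : R[X]}
    {t : R →+* S} (ht : t Q.leadingCoeff = 0) : Q.eraseLead.map t = Q.map t := by
  conv_rhs => rw [← Q.eraseLead_add_monomial_natDegree_leadingCoeff]
  rw [Polynomial.map_add, map_monomial, ht, monomial_zero_right, add_zero]

/-- The specializations of the polynomials of `F` along `t` and `t'` have equal signs at `x` and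
`y` respectively. -/
def SignEqAt (F : Set R[X]) (t t' : R →+* ℝ) (x y : ℝ) : Prop :=
  ∀ P ∈ F, sign ((P.map t).eval x) = sign ((P.map t').eval y)

theorem SignEqAt.mono {F G : Set R[X]} {t t' : R →+* ℝ} {x y : ℝ} (h : SignEqAt G t t' x y)
    (hFG : F ⊆ G) : SignEqAt F t t' x y :=
  fun P hP => h P (hFG hP)

theorem SignEqAt.sign_eq_of_C_mem {F : Set R[X]} {t t' : R →+* ℝ} {x y : ℝ}
    (h : SignEqAt F t t' x y) {c : R} (hc : C c ∈ F) : sign (t c) = sign (t' c) := by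
  simpa using h _ hc

theorem exists_signEqAt_of_isRoot (P Q : R[X]) :
    ∃ H : Set R[X], H.Finite ∧ (∀ g ∈ H, g.natDegree < Q.natDegree) ∧
      ∀ (t t' : R →+* ℝ) (x y : ℝ), Q.map t ≠ 0 → (Q.map t).IsRoot x → (Q.map t').IsRoot y →
        SignEqAt H t t' x y → sign ((P.map t).eval x) = sign ((P.map t').eval y) := by
  induction h : Q.natDegree using Nat.strong_induction_on generalizing Q with
  | _ n ih =>
    subst h
    rcases Nat.eq_zero_or_pos Q.natDegree with h0 | hpos
    · obtain ⟨c, rfl⟩ := natDegree_eq_zero.1 h0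
      refine ⟨∅, finite_empty, by simp, fun t t' x y hne hroot => absurd ?_ hne⟩
      simpa using hroot
    obtain ⟨g, A, k, hg, hdiv⟩ := exists_leadingCoeff_pow_mul_eq P Q hpos
    have herase : Q.eraseLead.natDegree < Q.natDegree := by
      have := Q.eraseLead_natDegree_le; lia
    obtain ⟨H, hHfin, hHdeg, hH⟩ := ih _ herase Q.eraseLead rfl
    refine ⟨insert (C Q.leadingCoeff) (insert g H), (hHfin.insert _).insert _, ?_,
      fun t t' x y hne hx hy hsign => ?_⟩
    · rintro f (rfl | rfl | hf)
      · simpa using hpos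
      · exact hg
      · exact (hHdeg f hf).trans herase
    have hlead : sign (t Q.leadingCoeff) = sign (t' Q.leadingCoeff) :=
      hsign.sign_eq_of_C_mem (mem_insert _ _)
    by_cases hl : t Q.leadingCoeff = 0
    · have hl' : t' Q.leadingCoeff = 0 := by rwa [← sign_eq_zero_iff, ← hlead, sign_eq_zero_iff]
      rw [← map_eraseLead_of_map_leadingCoeff_eq_zero hl] at hne hx
      rw [← map_eraseLead_of_map_leadingCoeff_eq_zero hl'] at hy
      exact hH t t' x y hne hx hy (hsign.mono fun f hf => Or.inr (Or.inr hf))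
    have hgsign := hsign g (Or.inr (Or.inl rfl))
    rw [← sign_eval_of_pow_mul_eq hdiv t hx, ← sign_eval_of_pow_mul_eq hdiv t' hy,
      ← hlead] at hgsign
    exact mul_left_cancel₀ (pow_ne_zero k (sign_ne_zero.2 hl)) hgsign

theorem exists_orderIso_signEqAt_insert {P : R[X]} {G : Set R[X]} (hG : G.Finite)
    {t t' : R →+* ℝ} {φ : ℝ ≃o ℝ} (hφ : ∀ x, SignEqAt G t t' x (φ x))
    (hlt : t P.leadingCoeff ≠ 0) (hl : sign (t P.leadingCoeff) = sign (t' P.leadingCoeff))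
    (hder : derivative P ∈ G) (hP : 0 < P.natDegree)
    (hroot : ∀ Q ∈ G, Q.map t ≠ 0 → ∀ x, (Q.map t).IsRoot x →
      sign ((P.map t).eval x) = sign ((P.map t').eval (φ x))) :
    ∃ φ' : ℝ ≃o ℝ, ∀ x, SignEqAt (insert P G) t t' x (φ' x) := by
  have hlt' : t' P.leadingCoeff ≠ 0 := by rwa [← sign_ne_zero, ← hl, sign_ne_zero]
  have hdeg := natDegree_map_of_leadingCoeff_ne_zero t hlt
  have hdeg' := natDegree_map_of_leadingCoeff_ne_zero t' hlt'
  have hder0 : derivative (P.map t) ≠ 0 := fun h => by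
    have := derivative_eq_zero.1 h
    lia
  set M : Set ℝ := ⋃ Q ∈ {Q ∈ G | Q.map t ≠ 0}, {x | (Q.map t).IsRoot x}
  have hMfin : M.Finite := (hG.subset (sep_subset _ _)).biUnion fun Q hQ =>
    finite_setOfPred_isRoot hQ.2
  have hmem : ∀ Q ∈ G, Q.map t ≠ 0 → ∀ x, (Q.map t).IsRoot x → x ∈ M := fun Q hQ h0 x hx =>
    mem_biUnion (show Q ∈ {Q ∈ G | Q.map t ≠ 0} from ⟨hQ, h0⟩) hx
  obtain ⟨ψ, hψM, hψ⟩ := exists_orderIso_sign_eval_eq (p := P.map t) (q := P.map t') (φ := φ)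
    hMfin
    (fun x hx => by
      obtain ⟨Q, ⟨hQ, h0⟩, hQx⟩ := mem_iUnion₂.1 hx
      exact hroot Q hQ h0 x hQx)
    (fun x hx => hmem _ hder (by rwa [← derivative_map]) x (by rwa [← derivative_map]))
    (fun x => by simpa only [derivative_map] using hφ x _ hder)
    (by simpa only [leadingCoeff_map_of_leadingCoeff_ne_zero t hlt,
      leadingCoeff_map_of_leadingCoeff_ne_zero t' hlt'] using hl)
    (hdeg.trans hdeg'.symm)
  refine ⟨ψ.trans φ, fun x Q hQ => ?_⟩
  rcases hQ with rfl | hQ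
  · exact hψ x
  · rw [OrderIso.trans_apply, ← hφ (ψ x) Q hQ]
    by_cases h0 : Q.map t = 0
    · simp only [h0, eval_zero]
    · exact (sign_eval_orderIso_eq (fun z hz => hψM z (hmem Q hQ h0 z hz)) x).symm

/-- The real line is divided up in the same way, up to an order isomorphism, by the
specializations of the polynomials in `F` along any two ring homomorphisms that give the same
signs to finitely many coefficients. -/
def SignDetermined (F : Set R[X]) : Prop :=
  ∃ C : Set R, C.Finite ∧ ∀ t t' : R →+* ℝ, (∀ c ∈ C, sign (t c) = sign (t' c)) →
    ∃ φ : ℝ ≃o ℝ, ∀ x, SignEqAt F t t' x (φ x)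

theorem SignDetermined.insert_of_natDegree_eq_zero {F : Set R[X]} (hF : SignDetermined F)
    {P : R[X]} (hP : P.natDegree = 0) : SignDetermined (insert P F) := by
  obtain ⟨C, hC, h⟩ := hF
  obtain ⟨c, rfl⟩ := natDegree_eq_zero.1 hP
  refine ⟨insert c C, hC.insert c, fun t t' ht => ?_⟩
  obtain ⟨φ, hφ⟩ := h t t' fun c hc => ht c (mem_insert_of_mem _ hc)
  refine ⟨φ, fun x Q hQ => ?_⟩
  rcases hQ with rfl | hQ
  · simpa using ht c (mem_insert _ _)
  · exact hφ x Q hQ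

theorem SignDetermined.insert_of_natDegree_pos {P : R[X]} {G : Set R[X]} (hG : G.Finite)
    (hGP : ∀ Q ∈ G, Q.natDegree ≤ P.natDegree) (hP : 0 < P.natDegree)
    (ih : ∀ H : Set R[X], H.Finite → (∀ Q ∈ H, Q.natDegree < P.natDegree) →
      SignDetermined (G ∪ H)) : SignDetermined (insert P G) := by
  choose H hHfin hHdeg hH using exists_signEqAt_of_isRoot P
  have hderdeg := natDegree_derivative_lt (p := P) (by lia)
  have hGdeg : ∀ Q ∈ insert (derivative P) G, Q.natDegree ≤ P.natDegree := by
    rintro Q (rfl | hQ)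
    exacts [hderdeg.le, hGP Q hQ]
  set D : Set R[X] := {C P.leadingCoeff, P.eraseLead, derivative P} with hD
  obtain ⟨A, hA, hdet⟩ := ih (D ∪ ⋃ Q ∈ insert (derivative P) G, H Q)
    ((by simp [hD] : D.Finite).union ((hG.insert _).biUnion fun Q _ => hHfin Q)) (by
      rintro Q (hQ | hQ)
      · rcases hQ with rfl | rfl | rfl
        · rwa [natDegree_C]
        · have := P.eraseLead_natDegree_le; lia
        · exact hderdeg
      · obtain ⟨Q', hQ', hQ⟩ := mem_iUnion₂.1 hQ
        exact (hHdeg Q' Q hQ).trans_le (hGdeg Q' hQ'))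
  refine ⟨A, hA, fun t t' ht => ?_⟩
  obtain ⟨φ, hφ⟩ := hdet t t' ht
  have hφG : ∀ x, SignEqAt (insert (derivative P) G) t t' x (φ x) := fun x =>
    (hφ x).mono (insert_subset (by simp [hD]) subset_union_left)
  have hlead : sign (t P.leadingCoeff) = sign (t' P.leadingCoeff) :=
    (hφ 0).sign_eq_of_C_mem (by simp [hD])
  by_cases hl : t P.leadingCoeff = 0
  · have hl' : t' P.leadingCoeff = 0 := by rwa [← sign_eq_zero_iff, ← hlead, sign_eq_zero_iff]
    refine ⟨φ, fun x Q hQ => ?_⟩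
    rcases hQ with rfl | hQ
    · rw [← map_eraseLead_of_map_leadingCoeff_eq_zero hl,
        ← map_eraseLead_of_map_leadingCoeff_eq_zero hl']
      exact hφ x _ (by simp [hD])
    · exact hφ x Q (Or.inl hQ)
  · obtain ⟨φ', hφ'⟩ := exists_orderIso_signEqAt_insert (hG.insert _) hφG hl hlead
      (mem_insert _ _) hP fun Q hQ hQ0 x hx => hH Q t t' x (φ x) hQ0 hx
        (by rw [IsRoot, ← sign_eq_zero_iff, ← hφG x Q hQ, sign_eq_zero_iff]; exact hx)
        ((hφ x).mono fun g hg => Or.inr (Or.inr (mem_biUnion hQ hg)))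
    exact ⟨φ', fun x => (hφ' x).mono (insert_subset_insert (subset_insert _ _))⟩

theorem finite_induction_natDegree {motive : Set R[X] → Prop} (hempty : motive ∅)
    (hinsert : ∀ P G, G.Finite → (∀ Q ∈ G, Q.natDegree ≤ P.natDegree) →
      (∀ H : Set R[X], H.Finite → (∀ Q ∈ H, Q.natDegree < P.natDegree) → motive (G ∪ H)) →
      motive (insert P G)) {F : Set R[X]} (hF : F.Finite) : motive F := by
  obtain ⟨d, hd⟩ : ∃ d, ∀ P ∈ F, P.natDegree < d := by
    obtain ⟨d, hd⟩ := (hF.image natDegree).bddAbove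
    exact ⟨d + 1, fun P hP => Nat.lt_succ_of_le (hd ⟨P, hP, rfl⟩)⟩
  induction d generalizing F with
  | zero => rwa [eq_empty_of_forall_notMem fun P hP => Nat.not_lt_zero _ (hd P hP)]
  | succ d ih =>
    suffices key : ∀ G : Set R[X], G.Finite → (∀ Q ∈ G, Q.natDegree < d) → motive (F ∪ G) by
      simpa using key ∅ finite_empty (by simp)
    induction F, hF using Set.Finite.induction_on with
    | empty => intro G hG hGd; rw [empty_union]; exact ih hG hGd
    | @insert P F _ hF ihF =>
      intro G hG hGd
      have hFd : ∀ Q ∈ F, Q.natDegree < d + 1 := fun Q hQ => hd Q (mem_insert_of_mem _ hQ)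
      rcases (Nat.lt_succ_iff.1 (hd P (mem_insert _ _))).lt_or_eq with hP | hP
      · rw [insert_union, ← union_insert]
        exact ihF hFd _ (hG.insert _) (forall_mem_insert.2 ⟨hP, hGd⟩)
      rw [insert_union]
      refine hinsert P _ (hF.union hG) ?_ fun H hH hHd => ?_
      · rintro Q (hQ | hQ)
        · have := hFd Q hQ; lia
        · have := hGd Q hQ; lia
      · rw [union_assoc]
        refine ihF hFd _ (hG.union hH) ?_
        rintro Q (hQ | hQ)
        exacts [hGd Q hQ, hP ▸ hHd Q hQ]

theorem signDetermined_of_finite {F : Set R[X]} (hF : F.Finite) : SignDetermined F := by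
  refine finite_induction_natDegree (motive := SignDetermined)
    ⟨∅, finite_empty, fun _ _ _ => ⟨OrderIso.refl ℝ, by simp [SignEqAt]⟩⟩
    (fun P G hG hGP ih => ?_) hF
  rcases Nat.eq_zero_or_pos P.natDegree with h0 | hpos
  · exact SignDetermined.insert_of_natDegree_eq_zero
      (by simpa using ih ∅ finite_empty (by simp)) h0
  · exact SignDetermined.insert_of_natDegree_pos hG hGP hpos ih

end SignDetermined

/-! ### Semialgebraic sets -/

section Semialgebraic

open SignType (sign)

variable {E : Type*} [NormedAddCommGroup E] [NormedSpace ℝ E]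
  {F : Type*} [NormedAddCommGroup F] [NormedSpace ℝ F]
  {G : Type*} [NormedAddCommGroup G] [NormedSpace ℝ G]

theorem const_mem_realPolyFunctions (c : ℝ) : (fun _ : E => c) ∈ realPolyFunctions E :=
  (realPolyFunctions E).algebraMap_mem c

theorem linear_mem_realPolyFunctions (l : E →ₗ[ℝ] ℝ) : (fun x => l x) ∈ realPolyFunctions E :=
  Algebra.subset_adjoin ⟨l, rfl⟩

theorem realPolyFunctions_induction {P : (p : E → ℝ) → p ∈ realPolyFunctions E → Prop}
    (linear : ∀ l : E →ₗ[ℝ] ℝ, P (fun x => l x) (linear_mem_realPolyFunctions l))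
    (const : ∀ c : ℝ, P (fun _ => c) (const_mem_realPolyFunctions c))
    (add : ∀ f g hf hg, P f hf → P g hg → P (f + g) (add_mem hf hg))
    (mul : ∀ f g hf hg, P f hf → P g hg → P (f * g) (mul_mem hf hg))
    {p : E → ℝ} (hp : p ∈ realPolyFunctions E) : P p hp := by
  induction hp using Algebra.adjoin_induction with
  | mem x hx => obtain ⟨l, rfl⟩ := hx; exact linear l
  | algebraMap r => exact const r
  | add x y hx hy h h' => exact add x y hx hy h h'
  | mul x y hx hy h h' => exact mul x y hx hy h h'

/-- Maps all of whose components are polynomial functions. -/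
def IsPolyMap (φ : E → F) : Prop :=
  ∀ l : F →ₗ[ℝ] ℝ, (fun x => l (φ x)) ∈ realPolyFunctions E

theorem IsPolyMap.comp_mem {φ : E → F} (hφ : IsPolyMap φ) {p : F → ℝ}
    (hp : p ∈ realPolyFunctions F) : (fun x => p (φ x)) ∈ realPolyFunctions E := by
  induction hp using realPolyFunctions_induction with
  | linear l => exact hφ l
  | const c => exact const_mem_realPolyFunctions c
  | add f g _ _ hf hg => exact (realPolyFunctions E).add_mem hf hg
  | mul f g _ _ hf hg => exact (realPolyFunctions E).mul_mem hf hg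

theorem isPolyMap_real {f : E → ℝ} : IsPolyMap f ↔ f ∈ realPolyFunctions E := by
  refine ⟨fun h => h LinearMap.id, fun h l => ?_⟩
  have : (fun x => l (f x)) = (fun _ => l 1) * f := by
    funext x
    rw [Pi.mul_apply, mul_comm, ← smul_eq_mul, ← l.map_smul, smul_eq_mul, mul_one]
  rw [this]
  exact (realPolyFunctions E).mul_mem (const_mem_realPolyFunctions _) h

theorem IsPolyMap.comp {φ : F → G} {ψ : E → F} (hφ : IsPolyMap φ) (hψ : IsPolyMap ψ) :
    IsPolyMap fun x => φ (ψ x) :=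
  fun l => hψ.comp_mem (hφ l)

theorem isPolyMap_linearMap (φ : E →ₗ[ℝ] F) : IsPolyMap φ :=
  fun l => linear_mem_realPolyFunctions (l ∘ₗ φ)

theorem isPolyMap_const (c : F) : IsPolyMap fun _ : E => c :=
  fun l => const_mem_realPolyFunctions (l c)

theorem isPolyMap_id : IsPolyMap fun x : E => x :=
  isPolyMap_linearMap LinearMap.id

theorem IsPolyMap.fst {φ : E → F × G} (h : IsPolyMap φ) : IsPolyMap fun x => (φ x).1 :=
  (isPolyMap_linearMap (LinearMap.fst ℝ F G)).comp h

theorem IsPolyMap.snd {φ : E → F × G} (h : IsPolyMap φ) : IsPolyMap fun x => (φ x).2 :=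
  (isPolyMap_linearMap (LinearMap.snd ℝ F G)).comp h

theorem IsPolyMap.sub {φ ψ : E → F} (hφ : IsPolyMap φ) (hψ : IsPolyMap ψ) :
    IsPolyMap fun x => φ x - ψ x := fun l => by
  simp only [map_sub]
  exact (realPolyFunctions E).sub_mem (hφ l) (hψ l)

theorem IsPolyMap.smul {f : E → ℝ} {φ : E → F} (hf : IsPolyMap f) (hφ : IsPolyMap φ) :
    IsPolyMap fun x => f x • φ x := fun l => by
  simp only [map_smul]
  exact (realPolyFunctions E).mul_mem (isPolyMap_real.1 hf) (hφ l)

theorem IsPolyMap.prodMk {φ : E → F} {ψ : E → G} (hφ : IsPolyMap φ) (hψ : IsPolyMap ψ) :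
    IsPolyMap fun x => (φ x, ψ x) := fun l => by
  have := (realPolyFunctions E).add_mem (hφ (l ∘ₗ LinearMap.inl ℝ F G))
    (hψ (l ∘ₗ LinearMap.inr ℝ F G))
  convert this using 1
  funext x
  simp [← map_add]

theorem IsPolyMap.finsetSum {ι : Type*} (s : Finset ι) {φ : ι → E → F}
    (h : ∀ i ∈ s, IsPolyMap (φ i)) : IsPolyMap fun x => ∑ i ∈ s, φ i x := fun l => by
  have := (realPolyFunctions E).sum_mem fun i hi => h i hi l
  convert this using 1
  funext x
  simp

theorem isPolyMap_pi {k : ℕ} {φ : E → Fin k → ℝ} (h : ∀ i, IsPolyMap fun x => φ x i) :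
    IsPolyMap φ := by
  have : φ = fun x => ∑ i, φ x i • (Pi.single i 1 : Fin k → ℝ) := by
    funext x; exact pi_eq_sum_univ' (φ x)
  rw [this]
  exact IsPolyMap.finsetSum _ fun i _ => (h i).smul (isPolyMap_const _)

theorem isPolyMap_cons {k : ℕ} :
    IsPolyMap fun z : (E × ℝ) × (Fin k → ℝ) =>
      (z.1.1, (Fin.cons z.1.2 z.2 : Fin (k + 1) → ℝ)) :=
  isPolyMap_id.fst.fst.prodMk (isPolyMap_pi fun i => by
    refine Fin.cases ?_ (fun i => ?_) i
    · simpa only [Fin.cons_zero] using isPolyMap_id.fst.snd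
    · simp only [Fin.cons_succ]
      exact (isPolyMap_linearMap
        (LinearMap.proj (R := ℝ) (φ := fun _ : Fin k => ℝ) i)).comp isPolyMap_id.snd)

theorem isSemialgebraic_lt {f g : E → ℝ} (hf : IsPolyMap f) (hg : IsPolyMap g) :
    IsSemialgebraic {x | f x < g x} := by
  have := IsSemialgebraic.pos _ (isPolyMap_real.1 (hg.sub hf))
  simpa using this

theorem IsSemialgebraic.preimage {s : Set F} (hs : IsSemialgebraic s) {φ : E → F}
    (hφ : IsPolyMap φ) : IsSemialgebraic (φ ⁻¹' s) := by
  induction hs with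
  | pos p hp => exact IsSemialgebraic.pos _ (hφ.comp_mem hp)
  | compl s _ ih => exact ih.compl
  | union s t _ _ ihs iht => exact ihs.union _ _ iht

theorem IsSemialgebraic.or {P Q : E → Prop} (hP : IsSemialgebraic {x | P x})
    (hQ : IsSemialgebraic {x | Q x}) : IsSemialgebraic {x | P x ∨ Q x} :=
  hP.union _ _ hQ

theorem IsSemialgebraic.not {P : E → Prop} (hP : IsSemialgebraic {x | P x}) :
    IsSemialgebraic {x | ¬ P x} :=
  hP.compl

theorem IsSemialgebraic.and {P Q : E → Prop} (hP : IsSemialgebraic {x | P x})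
    (hQ : IsSemialgebraic {x | Q x}) : IsSemialgebraic {x | P x ∧ Q x} := by
  have := (hP.not.or hQ.not).not
  simpa only [not_or, not_not] using this

theorem IsSemialgebraic.imp {P Q : E → Prop} (hP : IsSemialgebraic {x | P x})
    (hQ : IsSemialgebraic {x | Q x}) : IsSemialgebraic {x | P x → Q x} := by
  have := hP.not.or hQ
  simpa only [← imp_iff_not_or] using this

theorem IsSemialgebraic.inter {s t : Set E} (hs : IsSemialgebraic s) (ht : IsSemialgebraic t) :
    IsSemialgebraic (s ∩ t) :=
  IsSemialgebraic.and hs ht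

theorem isSemialgebraic_univ : IsSemialgebraic (univ : Set E) := by
  simpa using IsSemialgebraic.pos _ (const_mem_realPolyFunctions (E := E) 1)

theorem isSemialgebraic_eq_zero {f : E → ℝ} (hf : IsPolyMap f) :
    IsSemialgebraic {x | f x = 0} := by
  have h := ((isSemialgebraic_lt hf (isPolyMap_const 0)).or
    (isSemialgebraic_lt (isPolyMap_const 0) hf)).not
  convert h using 3 with x
  rw [← lt_or_lt_iff_ne.not_left]

theorem IsSemialgebraic.biInter {ι : Type*} {I : Set ι} (hI : I.Finite) {s : ι → Set E}
    (h : ∀ i ∈ I, IsSemialgebraic (s i)) : IsSemialgebraic (⋂ i ∈ I, s i) := by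
  induction I, hI using Set.Finite.induction_on with
  | empty => simpa using isSemialgebraic_univ
  | insert _ _ ih =>
    rw [biInter_insert]
    exact (h _ (mem_insert _ _)).inter (ih fun i hi => h i (mem_insert_of_mem _ hi))

theorem IsSemialgebraic.biUnion {ι : Type*} {I : Set ι} (hI : I.Finite) {s : ι → Set E}
    (h : ∀ i ∈ I, IsSemialgebraic (s i)) : IsSemialgebraic (⋃ i ∈ I, s i) := by
  have := (IsSemialgebraic.biInter hI fun i hi => (h i hi).compl).compl
  simpa using this

/-- Membership in `s` is determined by the signs of the polynomial functions in `C`. -/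
def DeterminedBySigns (C : Set (E → ℝ)) (s : Set E) : Prop :=
  ∀ x y, (∀ p ∈ C, sign (p x) = sign (p y)) → x ∈ s → y ∈ s

theorem IsSemialgebraic.exists_determinedBySigns {s : Set E} (hs : IsSemialgebraic s) :
    ∃ C : Set (E → ℝ), C.Finite ∧ C ⊆ realPolyFunctions E ∧ DeterminedBySigns C s := by
  induction hs with
  | pos p hp =>
    refine ⟨{p}, finite_singleton p, by simpa using hp, fun x y h hx => ?_⟩
    have := h p rfl
    rw [mem_ofPred_eq, ← sign_eq_one_iff] at hx ⊢
    rw [← this, hx]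
  | compl s _ ih =>
    obtain ⟨C, hC, hCp, hCs⟩ := ih
    exact ⟨C, hC, hCp, fun x y h hx hy => hx (hCs y x (fun p hp => (h p hp).symm) hy)⟩
  | union s t _ _ ihs iht =>
    obtain ⟨C, hC, hCp, hCs⟩ := ihs
    obtain ⟨D, hD, hDp, hDs⟩ := iht
    refine ⟨C ∪ D, hC.union hD, union_subset hCp hDp, fun x y h hx => ?_⟩
    rcases hx with hx | hx
    · exact Or.inl (hCs x y (fun p hp => h p (Or.inl hp)) hx)
    · exact Or.inr (hDs x y (fun p hp => h p (Or.inr hp)) hx)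

theorem isSemialgebraic_sign_eq {p : E → ℝ} (hp : p ∈ realPolyFunctions E) (σ : SignType) :
    IsSemialgebraic {x | sign (p x) = σ} := by
  have hp := isPolyMap_real.2 hp
  cases σ
  · simpa only [SignType.zero_eq_zero, sign_eq_zero_iff] using isSemialgebraic_eq_zero hp
  · simpa only [SignType.neg_eq_neg_one, sign_eq_neg_one_iff] using
      isSemialgebraic_lt hp (isPolyMap_const 0)
  · simpa only [SignType.pos_eq_one, sign_eq_one_iff] using
      isSemialgebraic_lt (isPolyMap_const 0) hp

theorem DeterminedBySigns.isSemialgebraic {s : Set E} {C : Set (E → ℝ)} (hC : C.Finite)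
    (hCp : C ⊆ realPolyFunctions E) (hs : DeterminedBySigns C s) : IsSemialgebraic s := by
  have : Finite C := hC
  let σ : E → C → SignType := fun x p => sign (p.1 x)
  have : s = ⋃ τ ∈ σ '' s, ⋂ p ∈ (univ : Set C), {x | sign (p.1 x) = τ p} := by
    ext y
    simp only [mem_iUnion, mem_iInter, mem_ofPred_eq, exists_prop, mem_image, mem_univ,
      forall_true_left]
    constructor
    · exact fun hy => ⟨σ y, ⟨y, hy, rfl⟩, fun _ => rfl⟩
    · rintro ⟨_, ⟨x, hx, rfl⟩, h⟩
      exact hs x y (fun p hp => (h ⟨p, hp⟩).symm) hx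
  rw [this]
  exact IsSemialgebraic.biUnion (Set.toFinite _) fun τ _ => IsSemialgebraic.biInter
    (Set.toFinite _) fun p _ => isSemialgebraic_sign_eq (hCp p.2) _

/-! ### Projections of semialgebraic sets -/

/-- Evaluation of polynomial functions at a point. -/
noncomputable def polyEval (x : E) : realPolyFunctions E →+* ℝ :=
  (Pi.evalRingHom (fun _ : E => ℝ) x).comp (realPolyFunctions E).toSubring.subtype

/-- The function on `E × ℝ` given by a polynomial in the last variable whose coefficients are
polynomial functions on `E`. -/
noncomputable def polyFun : Polynomial (realPolyFunctions E) →+* (E × ℝ → ℝ) :=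
  RingHom.pi fun z => (Polynomial.evalRingHom z.2).comp (Polynomial.mapRingHom (polyEval z.1))

theorem polyFun_apply (P : Polynomial (realPolyFunctions E)) (z : E × ℝ) :
    polyFun P z = (P.map (polyEval z.1)).eval z.2 :=
  rfl

theorem polyFun_C (a : realPolyFunctions E) (z : E × ℝ) :
    polyFun (Polynomial.C a) z = a.1 z.1 := by
  rw [polyFun_apply, Polynomial.map_C, Polynomial.eval_C]
  rfl

theorem polyFun_X (z : E × ℝ) : polyFun Polynomial.X z = z.2 := by
  rw [polyFun_apply, Polynomial.map_X, Polynomial.eval_X]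

theorem exists_polyFun_eq {p : E × ℝ → ℝ} (hp : p ∈ realPolyFunctions (E × ℝ)) :
    ∃ P : Polynomial (realPolyFunctions E), polyFun P = p := by
  induction hp using realPolyFunctions_induction with
  | linear l =>
    refine ⟨Polynomial.C ⟨_, linear_mem_realPolyFunctions (l ∘ₗ LinearMap.inl ℝ E ℝ)⟩ +
      Polynomial.C ⟨_, const_mem_realPolyFunctions (l (0, 1))⟩ * Polynomial.X, ?_⟩
    funext ⟨x, r⟩
    have hxr : (x, r) = (x, (0 : ℝ)) + r • ((0 : E), (1 : ℝ)) := by simp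
    rw [hxr, map_add l, map_smul l, smul_eq_mul, mul_comm, ← hxr, map_add, map_mul,
      Pi.add_apply, Pi.mul_apply, polyFun_C, polyFun_C, polyFun_X]
    rfl
  | const c =>
    exact ⟨Polynomial.C ⟨_, const_mem_realPolyFunctions c⟩, funext fun z => polyFun_C _ z⟩
  | add f g _ _ hf hg =>
    obtain ⟨P, rfl⟩ := hf
    obtain ⟨Q, rfl⟩ := hg
    exact ⟨P + Q, map_add polyFun P Q⟩
  | mul f g _ _ hf hg =>
    obtain ⟨P, rfl⟩ := hf
    obtain ⟨Q, rfl⟩ := hg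
    exact ⟨P * Q, map_mul polyFun P Q⟩

theorem IsSemialgebraic.exists_determinedBySigns_polyFun {s : Set (E × ℝ)}
    (hs : IsSemialgebraic s) :
    ∃ I : Set (Polynomial (realPolyFunctions E)), I.Finite ∧
      DeterminedBySigns (polyFun '' I) s := by
  obtain ⟨C, hC, hCp, hCs⟩ := hs.exists_determinedBySigns
  obtain ⟨I, -, hI, rfl⟩ := (exists_subset_image_finite_and (p := fun D => D = C)).1
    ⟨C, (fun p hp => (exists_polyFun_eq (hCp hp)).imp fun P hP => ⟨mem_univ P, hP⟩), hC, rfl⟩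
  exact ⟨I, hI, hCs⟩

theorem IsSemialgebraic.exists_real {s : Set (E × ℝ)} (hs : IsSemialgebraic s) :
    IsSemialgebraic {x | ∃ r, (x, r) ∈ s} := by
  obtain ⟨I, hI, hIs⟩ := hs.exists_determinedBySigns_polyFun
  obtain ⟨D, hD, hDs⟩ := signDetermined_of_finite hI
  refine DeterminedBySigns.isSemialgebraic (C := Subtype.val '' D) (hD.image _)
    (by rintro _ ⟨d, _, rfl⟩; exact d.2) fun x y hxy => ?_
  rintro ⟨r, hr⟩
  obtain ⟨φ, hφ⟩ := hDs (polyEval x) (polyEval y) fun c hc => hxy _ ⟨c, hc, rfl⟩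
  refine ⟨φ r, hIs (x, r) (y, φ r) ?_ hr⟩
  rintro _ ⟨P, hP, rfl⟩
  exact hφ r P hP

theorem IsSemialgebraic.exists_pi {k : ℕ} {E : Type*} [NormedAddCommGroup E] [NormedSpace ℝ E]
    {s : Set (E × (Fin k → ℝ))} (hs : IsSemialgebraic s) :
    IsSemialgebraic {x | ∃ r, (x, r) ∈ s} := by
  induction k generalizing E with
  | zero =>
    have := hs.preimage (φ := fun x : E => (x, (0 : Fin 0 → ℝ)))
      (isPolyMap_id.prodMk (isPolyMap_const _))
    convert this using 1
    ext x
    exact ⟨fun ⟨r, hr⟩ => by rwa [Subsingleton.elim r 0] at hr, fun h => ⟨0, h⟩⟩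
  | succ k ih =>
    convert (ih (hs.preimage isPolyMap_cons)).exists_real using 1
    ext x
    simp only [mem_ofPred_eq, mem_preimage]
    exact Fin.exists_fin_succ_pi (P := fun r => (x, r) ∈ s)

/-- The **Tarski–Seidenberg theorem**. -/
theorem IsSemialgebraic.exists [FiniteDimensional ℝ F] {s : Set (E × F)}
    (hs : IsSemialgebraic s) : IsSemialgebraic {x | ∃ y, (x, y) ∈ s} := by
  let e := (Module.finBasis ℝ F).equivFun
  have hpi := hs.preimage (φ := fun z : E × (Fin (Module.finrank ℝ F) → ℝ) => (z.1, e.symm z.2))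
    (isPolyMap_id.fst.prodMk ((isPolyMap_linearMap e.symm.toLinearMap).comp isPolyMap_id.snd))
  convert hpi.exists_pi using 1
  ext x
  simp only [mem_ofPred_eq, mem_preimage]
  exact e.symm.surjective.exists

theorem IsSemialgebraic.forall [FiniteDimensional ℝ F] {s : Set (E × F)}
    (hs : IsSemialgebraic s) : IsSemialgebraic {x | ∀ y, (x, y) ∈ s} := by
  have := hs.compl.exists.compl
  convert this using 1
  ext x
  simp

/-! ### Zero sets of polynomial functions -/

theorem contDiff_of_mem_realPolyFunctions [FiniteDimensional ℝ E] {k : WithTop ℕ∞} {p : E → ℝ}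
    (hp : p ∈ realPolyFunctions E) : ContDiff ℝ k p := by
  induction hp using realPolyFunctions_induction with
  | linear l => exact l.toContinuousLinearMap.contDiff
  | const c => exact contDiff_const
  | add f g _ _ hf hg => exact hf.add hg
  | mul f g _ _ hf hg => exact hf.mul hg

theorem exists_polynomial_line {p : E → ℝ} (hp : p ∈ realPolyFunctions E) (a b : E) :
    ∃ P : Polynomial ℝ, ∀ r : ℝ, p (a + r • b) = P.eval r := by
  induction hp using realPolyFunctions_induction with
  | linear l =>
    exact ⟨Polynomial.C (l a) + Polynomial.C (l b) * Polynomial.X, fun r => by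
      simp [mul_comm r]⟩
  | const c => exact ⟨Polynomial.C c, by simp⟩
  | add f g _ _ hf hg =>
    obtain ⟨P, hP⟩ := hf
    obtain ⟨Q, hQ⟩ := hg
    exact ⟨P + Q, fun x => by simp [hP, hQ]⟩
  | mul f g _ _ hf hg =>
    obtain ⟨P, hP⟩ := hf
    obtain ⟨Q, hQ⟩ := hg
    exact ⟨P * Q, fun x => by simp [hP, hQ]⟩

theorem dense_ne_zero_of_mem_realPolyFunctions {p : E → ℝ} (hp : p ∈ realPolyFunctions E)
    (h0 : p ≠ 0) : Dense {x | p x ≠ 0} := by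
  obtain ⟨b, hb⟩ := Function.ne_iff.1 h0
  intro a
  obtain ⟨P, hP⟩ := exists_polynomial_line hp a (b - a)
  have hP0 : P ≠ 0 := by
    rintro rfl
    exact hb (by simpa using hP 1)
  have hne : ∀ᶠ r in 𝓝[≠] (0 : ℝ), p (a + r • (b - a)) ≠ 0 := by
    have hfin : {r | P.IsRoot r}.Finite := Polynomial.finite_setOfPred_isRoot hP0
    have hroots : ∀ᶠ r in 𝓝[≠] (0 : ℝ), r ∉ {r | P.IsRoot r} \ {0} := nhdsWithin_le_nhds
      ((hfin.subset sdiff_subset).isClosed.isOpen_compl.mem_nhds (by simp))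
    filter_upwards [hroots, self_mem_nhdsWithin] with r hr hr0
    rw [hP]
    exact fun h => hr ⟨h, hr0⟩
  have hline : Tendsto (fun r : ℝ => a + r • (b - a)) (𝓝[≠] 0) (𝓝 a) := by
    have : ContinuousAt (fun r : ℝ => a + r • (b - a)) 0 := by fun_prop
    simpa [ContinuousAt] using this.mono_left nhdsWithin_le_nhds
  exact mem_closure_of_tendsto hline hne

theorem mul_ne_zero_of_mem_realPolyFunctions {p q : E → ℝ} (hp : p ∈ realPolyFunctions E)
    (hq : q ∈ realPolyFunctions E) (hp0 : p ≠ 0) (hq0 : q ≠ 0) : p * q ≠ 0 := by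
  obtain ⟨b, hb⟩ := Function.ne_iff.1 hp0
  obtain ⟨c, hc⟩ := Function.ne_iff.1 hq0
  obtain ⟨P, hP⟩ := exists_polynomial_line hp b (c - b)
  obtain ⟨Q, hQ⟩ := exists_polynomial_line hq b (c - b)
  have hP0 : P ≠ 0 := by
    rintro rfl
    exact hb (by simpa using hP 0)
  have hQ0 : Q ≠ 0 := by
    rintro rfl
    exact hc (by simpa using hQ 1)
  intro h
  refine mul_ne_zero hP0 hQ0 (Polynomial.funext fun r => ?_)
  have := congrFun h (b + r • (c - b))
  rw [Pi.mul_apply, hP, hQ] at this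
  simpa using this

theorem exists_ne_zero_forall_eq_zero_of_finite {C : Set (E → ℝ)} (hC : C.Finite)
    (hCp : C ⊆ realPolyFunctions E) (h0 : ∀ p ∈ C, p ≠ 0) :
    ∃ q ∈ realPolyFunctions E, q ≠ 0 ∧ ∀ p ∈ C, ∀ x, p x = 0 → q x = 0 := by
  induction C, hC using Set.Finite.induction_on with
  | empty => exact ⟨1, one_mem _, one_ne_zero, by simp⟩
  | @insert p C _ _ ih =>
    obtain ⟨q, hq, hq0, h⟩ := ih ((subset_insert _ _).trans hCp)
      fun p hp => h0 p (mem_insert_of_mem _ hp)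
    refine ⟨p * q, mul_mem (hCp (mem_insert _ _)) hq, mul_ne_zero_of_mem_realPolyFunctions
      (hCp (mem_insert _ _)) hq (h0 p (mem_insert _ _)) hq0, ?_⟩
    rintro p' (rfl | hp') x hx
    · simp [hx]
    · simp [h p' hp' x hx]

theorem eventually_forall_sign_eq {ι X : Type*} [TopologicalSpace X] {I : Set ι} (hI : I.Finite)
    {f : ι → X → ℝ} {x : X} (hf : ∀ i ∈ I, ContinuousAt (f i) x)
    (h0 : ∀ i ∈ I, f i x = 0 → f i = 0) :
    ∀ᶠ y in 𝓝 x, ∀ i ∈ I, sign (f i x) = sign (f i y) := by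
  refine (eventually_all_finite hI).2 fun i hi => ?_
  by_cases hx : f i x = 0
  · simp [h0 i hi hx]
  · have hsign : ContinuousAt (fun y => sign (f i y)) x :=
      (continuousAt_sign_of_ne_zero hx).comp (hf i hi)
    exact hsign.eventually (p := fun σ => sign (f i x) = σ) (by simp)

theorem IsSemialgebraic.exists_ne_zero_eq_zero_of_notMem_interior [FiniteDimensional ℝ E]
    {s : Set E} (hs : IsSemialgebraic s) :
    ∃ q ∈ realPolyFunctions E, q ≠ 0 ∧ ∀ x ∈ s, x ∉ interior s → q x = 0 := by
  obtain ⟨C, hC, hCp, hCs⟩ := hs.exists_determinedBySigns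
  obtain ⟨q, hq, hq0, h⟩ := exists_ne_zero_forall_eq_zero_of_finite
    (hC.subset (sep_subset C fun p => p ≠ 0)) ((sep_subset _ _).trans hCp) fun p hp => hp.2
  refine ⟨q, hq, hq0, fun x hx => ?_⟩
  contrapose!
  intro hqx
  have hne : ∀ p ∈ C, p ≠ 0 → p x ≠ 0 := fun p hp hp0 hpx => hqx (h p ⟨hp, hp0⟩ x hpx)
  have hev : ∀ᶠ y in 𝓝 x, ∀ p ∈ C, sign (p x) = sign (p y) :=
    eventually_forall_sign_eq hC
      (fun p hp => (contDiff_of_mem_realPolyFunctions (k := 0) (hCp hp)).continuous.continuousAt)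
      fun p hp => not_imp_not.1 (hne p hp)
  exact mem_interior_iff_mem_nhds.2 (hev.mono fun y hy => hCs x y hy hx)

theorem IsSemialgebraic.isMeagre_diff_interior [FiniteDimensional ℝ E] {s : Set E}
    (hs : IsSemialgebraic s) : IsMeagre (s \ interior s) := by
  obtain ⟨q, hq, hq0, h⟩ := hs.exists_ne_zero_eq_zero_of_notMem_interior
  have hcl : IsClosed {x | q x = 0} :=
    isClosed_eq (contDiff_of_mem_realPolyFunctions (k := 0) hq).continuous continuous_const
  have hint : interior {x | q x = 0} = ∅ := by
    rw [interior_eq_empty_iff_dense_compl]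
    exact dense_ne_zero_of_mem_realPolyFunctions hq hq0
  have hnowhere : IsNowhereDense {x | q x = 0} := by rwa [IsNowhereDense, hcl.closure_eq]
  exact hnowhere.isMeagre.mono fun x hx => h x hx.1 hx.2

theorem inter_ne_zero_of_mem_realPolyFunctions [FiniteDimensional ℝ E] {U : Set E} (hUo : IsOpen U)
    (hUs : IsSemialgebraic U) {q : E → ℝ} (hq : q ∈ realPolyFunctions E) (hq0 : q ≠ 0) :
    IsOpen (U ∩ {x | q x ≠ 0}) ∧ U ⊆ closure (U ∩ {x | q x ≠ 0}) ∧
      IsSemialgebraic (U ∩ {x | q x ≠ 0}) :=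
  ⟨hUo.inter (isOpen_ne_fun (contDiff_of_mem_realPolyFunctions (k := 0) hq).continuous
      continuous_const),
    (dense_ne_zero_of_mem_realPolyFunctions hq hq0).open_subset_closure_inter hUo,
    hUs.inter (isSemialgebraic_eq_zero (isPolyMap_real.2 hq)).not⟩

end Semialgebraic

/-! ### Differentiable sections of semialgebraic families -/

section Sections

variable {E : Type*} [NormedAddCommGroup E] [NormedSpace ℝ E]

theorem polyFun_mem (P : Polynomial (realPolyFunctions E)) :
    polyFun P ∈ realPolyFunctions (E × ℝ) := by
  induction P using Polynomial.induction_on' with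
  | add P Q hP hQ =>
    rw [map_add]
    exact add_mem hP hQ
  | monomial n a =>
    have : polyFun (Polynomial.monomial n a) = (fun z => a.1 z.1) * (fun z => z.2) ^ n := by
      rw [← Polynomial.C_mul_X_pow_eq_monomial, map_mul, map_pow, funext (polyFun_C a),
        funext polyFun_X]
    rw [this]
    exact mul_mem (isPolyMap_id.fst.comp_mem a.2)
      (pow_mem (isPolyMap_real.1 isPolyMap_id.snd) n)

theorem polyFun_iterate_derivative (P : Polynomial (realPolyFunctions E)) (j : ℕ) (z : E × ℝ) :
    polyFun (Polynomial.derivative^[j] P) z =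
      (Polynomial.derivative^[j] (P.map (polyEval z.1))).eval z.2 := by
  rw [polyFun_apply, Polynomial.iterate_derivative_map]

theorem isSemialgebraic_polyFun_eq_zero (P : Polynomial (realPolyFunctions E)) :
    IsSemialgebraic {z | polyFun P z = 0} :=
  isSemialgebraic_eq_zero (isPolyMap_real.2 (polyFun_mem P))

theorem exists_simple_root_iterate_derivative {p : Polynomial ℝ} (hp : p ≠ 0) {x : ℝ}
    (hx : p.eval x = 0) : ∃ j, (Polynomial.derivative^[j] p).eval x = 0 ∧
      (Polynomial.derivative^[j + 1] p).eval x ≠ 0 := by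
  have hm : 0 < p.rootMultiplicity x := (Polynomial.rootMultiplicity_pos hp).2 hx
  refine ⟨p.rootMultiplicity x - 1,
    Polynomial.isRoot_iterate_derivative_of_lt_rootMultiplicity (by lia), ?_⟩
  rw [Nat.sub_add_cancel hm, Polynomial.eval_iterate_derivative_rootMultiplicity]
  exact smul_ne_zero (Nat.factorial_ne_zero _)
    (Polynomial.eval_divByMonic_pow_rootMultiplicity_ne_zero x hp)

/-- A semialgebraic subset of `E × ℝ` lying on the graph of a function on `E` which is
differentiable at the points over which the set lives. -/
def IsSemialgebraicGraph (L : Set (E × ℝ)) : Prop :=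
  IsSemialgebraic L ∧ ∃ g : E → ℝ, ∀ z ∈ L, z.2 = g z.1 ∧ DifferentiableAt ℝ g z.1

theorem isSemialgebraicGraph_const (c : ℝ) : IsSemialgebraicGraph {z : E × ℝ | z.2 = c} := by
  have h := isSemialgebraic_eq_zero
    ((isPolyMap_id (E := E × ℝ)).snd.sub (isPolyMap_const c))
  simp only [sub_eq_zero] at h
  exact ⟨h, fun _ => c, fun z hz => ⟨hz, differentiableAt_const c⟩⟩

/-- The set of simple roots of a polynomial whose coefficients are polynomial functions. -/
def simpleRoots (P : Polynomial (realPolyFunctions E)) : Set (E × ℝ) :=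
  {z | polyFun P z = 0 ∧ polyFun P.derivative z ≠ 0}

variable [FiniteDimensional ℝ E]
  {F : Type*} [NormedAddCommGroup F] [NormedSpace ℝ F] [FiniteDimensional ℝ F]

/-- The square of a Euclidean norm on a finite-dimensional space. In contrast to the given norm,
it is a polynomial function. -/
noncomputable def sqNorm (x : E) : ℝ := ‖toEuclidean x‖ ^ 2

theorem isPolyMap_sqNorm : IsPolyMap (sqNorm : E → ℝ) := by
  have : (sqNorm : E → ℝ) = fun x => ∑ i, toEuclidean x i • toEuclidean x i := by
    funext x
    rw [sqNorm, EuclideanSpace.real_norm_sq_eq]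
    simp only [sq, smul_eq_mul]
  rw [this]
  have h : ∀ i, IsPolyMap fun x : E => toEuclidean x i := fun i =>
    isPolyMap_linearMap ((EuclideanSpace.proj i : _ →L[ℝ] ℝ) ∘L
      (toEuclidean : E ≃L[ℝ] _).toContinuousLinearMap).toLinearMap
  exact IsPolyMap.finsetSum _ fun i _ => (h i).smul (h i)

theorem continuous_sqNorm : Continuous (sqNorm : E → ℝ) :=
  (toEuclidean.continuous.norm).pow 2

@[simp] theorem sqNorm_zero : sqNorm (0 : E) = 0 := by simp [sqNorm]

theorem exists_sqNorm_lt_subset {x : E} {V : Set E} (hV : V ∈ 𝓝 x) :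
    ∃ ε > 0, ∀ y, sqNorm (y - x) < ε → y ∈ V := by
  obtain ⟨ε, hε, h⟩ := Euclidean.nhds_basis_ball.mem_iff.1 hV
  refine ⟨ε ^ 2, by positivity, fun y hy => h ?_⟩
  rw [sqNorm, map_sub] at hy
  have := lt_of_pow_lt_pow_left₀ 2 hε.le hy
  rwa [← dist_eq_norm] at this

theorem exists_semialgebraic_nhds {x : E} {V : Set E} (hV : V ∈ 𝓝 x) :
    ∃ W ⊆ V, x ∈ W ∧ IsOpen W ∧ IsSemialgebraic W := by
  obtain ⟨ε, hε, h⟩ := exists_sqNorm_lt_subset hV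
  refine ⟨{y | sqNorm (y - x) < ε}, h, by simpa using hε,
    isOpen_lt (continuous_sqNorm.comp (continuous_id.sub continuous_const)) continuous_const, ?_⟩
  exact isSemialgebraic_lt (isPolyMap_sqNorm.comp (isPolyMap_id.sub (isPolyMap_const x)))
    (isPolyMap_const ε)

theorem exists_interior_of_countable_cover {ι : Type*} [Countable ι] {s : ι → Set E}
    (hs : ∀ i, IsSemialgebraic (s i)) {V : Set E} (hV : IsOpen V) (hne : V.Nonempty)
    (hVs : V ⊆ ⋃ i, s i) : ∃ i, (interior (s i) ∩ V).Nonempty := by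
  have : CompleteSpace E := FiniteDimensional.complete ℝ E
  by_contra! h
  refine not_isMeagre_of_isOpen hV hne ((isMeagre_iUnion fun i =>
    (hs i).isMeagre_diff_interior).mono fun x hx => ?_)
  obtain ⟨i, hi⟩ := mem_iUnion.1 (hVs hx)
  exact mem_iUnion.2 ⟨i, hi, fun hx' => (h i).subset ⟨hx', hx⟩⟩

theorem fderiv_polyFun (P : Polynomial (realPolyFunctions E)) (z : E × ℝ) :
    fderiv ℝ (polyFun P) z (0, 1) = polyFun P.derivative z := by
  have hpoly : HasFDerivAt (polyFun P) (fderiv ℝ (polyFun P) z) (z.1, z.2) :=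
    ((contDiff_of_mem_realPolyFunctions (polyFun_mem P)).differentiable one_ne_zero z).hasFDerivAt
  have hline : HasDerivAt (fun r : ℝ => (z.1, r)) (0, 1) z.2 :=
    (hasDerivAt_const _ _).prodMk (hasDerivAt_id _)
  have hcomp : HasDerivAt (polyFun P ∘ fun r : ℝ => (z.1, r)) (polyFun P.derivative z) z.2 := by
    have := (P.map (polyEval z.1)).hasDerivAt z.2
    rwa [Polynomial.derivative_map] at this
  exact (hpoly.comp_hasDerivAt z.2 hline).unique hcomp

theorem exists_isSemialgebraicGraph_mem_nhdsWithin {P : Polynomial (realPolyFunctions E)}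
    {z : E × ℝ} (hz : z ∈ simpleRoots P) :
    ∃ L ∈ 𝓝[simpleRoots P] z, IsSemialgebraicGraph L := by
  have : CompleteSpace E := FiniteDimensional.complete ℝ E
  have hc : ContDiffAt ℝ 1 (polyFun P) z :=
    (contDiff_of_mem_realPolyFunctions (polyFun_mem P)).contDiffAt
  have hinv : (fderiv ℝ (polyFun P) z ∘L .inr ℝ E ℝ).IsInvertible := by
    refine ⟨ContinuousLinearEquiv.unitsEquivAut ℝ (Units.mk0 _ hz.2), ?_⟩
    ext
    simp [fderiv_polyFun]
  set g := hc.implicitFunction one_ne_zero hinv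
  have hg : ∀ᶠ w in 𝓝 z, polyFun P w = polyFun P z ↔ g w.1 = w.2 :=
    hc.eventually_apply_eq_iff_implicitFunction one_ne_zero hinv
  have hgd : ∀ᶠ t in 𝓝 z.1, DifferentiableAt ℝ g t :=
    ((hc.contDiffAt_implicitFunction one_ne_zero hinv).eventually (by simp)).mono
      fun t ht => ht.differentiableAt one_ne_zero
  obtain ⟨W, hW, hzW, hWo, hWs⟩ := exists_semialgebraic_nhds
    (hg.and (continuousAt_fst.eventually hgd))
  refine ⟨W ∩ {w | polyFun P w = 0},
    inter_mem (mem_nhdsWithin_of_mem_nhds (hWo.mem_nhds hzW))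
      (mem_of_superset self_mem_nhdsWithin fun w hw => hw.1),
    hWs.inter (isSemialgebraic_polyFun_eq_zero P), g, fun w hw => ⟨?_, (hW hw.1).2⟩⟩
  exact ((hW hw.1).1.1 (hw.2.trans hz.1.symm)).symm

theorem exists_countable_graph_cover_simpleRoots (P : Polynomial (realPolyFunctions E)) :
    ∃ 𝓛 : Set (Set (E × ℝ)), 𝓛.Countable ∧ (∀ L ∈ 𝓛, IsSemialgebraicGraph L) ∧
      simpleRoots P ⊆ ⋃₀ 𝓛 := by
  choose! L hLn hLg using fun (z : E × ℝ) (hz : z ∈ simpleRoots P) =>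
    exists_isSemialgebraicGraph_mem_nhdsWithin hz
  obtain ⟨c, hcM, hc, hcov⟩ := TopologicalSpace.countable_cover_nhdsWithin hLn
  exact ⟨L '' c, hc.image L, forall_mem_image.2 fun z hz => hLg z (hcM hz),
    by rwa [sUnion_image]⟩

/-- There is a differentiable function on a nonempty open subset of `V` whose graph is
semialgebraic and contained in `K`. -/
def HasSemialgebraicSection (K : Set (E × ℝ)) (V : Set E) : Prop :=
  ∃ V' ⊆ V, IsOpen V' ∧ V'.Nonempty ∧ ∃ σ : E → ℝ, DifferentiableOn ℝ σ V' ∧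
    IsSemialgebraic {z : E × ℝ | z.1 ∈ V' ∧ z.2 = σ z.1} ∧ ∀ t ∈ V', (t, σ t) ∈ K

theorem IsSemialgebraicGraph.hasSemialgebraicSection {L : Set (E × ℝ)}
    (hL : IsSemialgebraicGraph L) {V : Set E} (hV : IsOpen V)
    (hne : (interior {t | ∃ r, (t, r) ∈ L} ∩ V).Nonempty) : HasSemialgebraicSection L V := by
  obtain ⟨hLs, g, hg⟩ := hL
  obtain ⟨t₀, ht₀⟩ := hne
  obtain ⟨V', hV', ht₀', hV'o, hV's⟩ :=
    exists_semialgebraic_nhds ((isOpen_interior.inter hV).mem_nhds ht₀)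
  have hgL : ∀ t ∈ V', (t, g t) ∈ L := fun t ht => by
    obtain ⟨r, hr⟩ := interior_subset (hV' ht).1
    rwa [← (hg _ hr).1]
  refine ⟨V', fun t ht => (hV' ht).2, hV'o, ⟨t₀, ht₀'⟩, g,
    fun t ht => (hg _ (hgL t ht)).2.differentiableWithinAt, ?_, hgL⟩
  convert (hV's.preimage (φ := Prod.fst) (isPolyMap_id (E := E × ℝ)).fst).inter hLs using 1
  ext ⟨t, r⟩
  refine and_congr_right fun ht => ⟨fun hr => ?_, fun hr => (hg _ hr).1⟩
  obtain rfl : r = g t := hr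
  exact hgL t ht

theorem hasSemialgebraicSection_of_countable_cover {K : Set (E × ℝ)} (hK : IsSemialgebraic K)
    {𝓛 : Set (Set (E × ℝ))} (h𝓛 : 𝓛.Countable) (hgraph : ∀ L ∈ 𝓛, IsSemialgebraicGraph L)
    {V : Set E} (hV : IsOpen V) (hne : V.Nonempty)
    (h : ∀ t ∈ V, ∃ r, (t, r) ∈ K ∧ (t, r) ∈ ⋃₀ 𝓛) : HasSemialgebraicSection K V := by
  have : Countable 𝓛 := h𝓛
  have hKL : ∀ L : 𝓛, IsSemialgebraicGraph (K ∩ L) := fun L =>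
    (hgraph L L.2).imp hK.inter (Exists.imp fun g hg z hz => hg z hz.2)
  obtain ⟨L, hL⟩ := exists_interior_of_countable_cover (s := fun L : 𝓛 => {t | ∃ r, (t, r) ∈ K ∩ L})
    (fun L => (hKL L).1.exists) hV hne fun t ht => by
      obtain ⟨r, hr, L, hL, hrL⟩ := h t ht
      exact mem_iUnion.2 ⟨⟨L, hL⟩, r, hr, hrL⟩
  obtain ⟨V', hV', ho, hn, σ, hσ, hσs, hσL⟩ := (hKL L).hasSemialgebraicSection hV hL
  exact ⟨V', hV', ho, hn, σ, hσ, hσs, fun t ht => (hσL t ht).1⟩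

theorem DeterminedBySigns.exists_rat_or_simpleRoot {I : Set (Polynomial (realPolyFunctions E))}
    (hI : I.Finite) {K : Set (E × ℝ)} (hK : DeterminedBySigns (polyFun '' I) K) {z : E × ℝ}
    (hz : z ∈ K) :
    (∃ c : ℚ, (z.1, (c : ℝ)) ∈ K) ∨
      ∃ P ∈ I, ∃ j, z ∈ simpleRoots (Polynomial.derivative^[j] P) := by
  obtain ⟨t, r⟩ := z
  refine or_iff_not_imp_right.2 fun hsimple => ?_
  have hzero : ∀ P ∈ I, polyFun P (t, r) = 0 → (fun r' => polyFun P (t, r')) = 0 := by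
    intro P hP hPr
    by_contra hne
    have hP0 : P.map (polyEval t) ≠ 0 := fun h0 => hne <| by
      funext r'
      rw [polyFun_apply, h0, Polynomial.eval_zero, Pi.zero_apply]
    obtain ⟨j, hj, hj'⟩ := exists_simple_root_iterate_derivative hP0 hPr
    refine hsimple ⟨P, hP, j, ?_, ?_⟩
    · rwa [polyFun_iterate_derivative]
    · rwa [← Function.iterate_succ_apply' Polynomial.derivative, polyFun_iterate_derivative]
  have hcont : ∀ P ∈ I, ContinuousAt (fun r' => polyFun P (t, r')) r := fun P _ =>
    ((contDiff_of_mem_realPolyFunctions (k := 0) (polyFun_mem P)).continuous.comp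
      (by fun_prop)).continuousAt
  obtain ⟨U, hU, hUo, hrU⟩ := mem_nhds_iff.1 (eventually_forall_sign_eq hI hcont hzero)
  obtain ⟨c, hc⟩ := Rat.denseRange_cast.exists_mem_open hUo ⟨r, hrU⟩
  exact ⟨c, hK _ _ (forall_mem_image.2 (hU hc)) hz⟩

theorem hasSemialgebraicSection {K : Set (E × ℝ)} (hK : IsSemialgebraic K)
    {V : Set E} (hV : IsOpen V) (hne : V.Nonempty) (h : ∀ t ∈ V, ∃ r, (t, r) ∈ K) :
    HasSemialgebraicSection K V := by
  obtain ⟨I, hI, hIK⟩ := hK.exists_determinedBySigns_polyFun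
  choose 𝓓 h𝓓 h𝓓g h𝓓cov using exists_countable_graph_cover_simpleRoots (E := E)
  refine hasSemialgebraicSection_of_countable_cover hK
    (𝓛 := (range fun c : ℚ => {z : E × ℝ | z.2 = c}) ∪
      ⋃ P ∈ I, ⋃ j : ℕ, 𝓓 (Polynomial.derivative^[j] P))
    ((countable_range _).union (hI.countable.biUnion fun P _ => countable_iUnion fun j => h𝓓 _))
    ?_ hV hne fun t ht => ?_
  · rintro L (⟨c, rfl⟩ | hL)
    · exact isSemialgebraicGraph_const _
    · obtain ⟨P, -, hL⟩ := mem_iUnion₂.1 hL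
      obtain ⟨j, hL⟩ := mem_iUnion.1 hL
      exact h𝓓g _ L hL
  · obtain ⟨r, hr⟩ := h t ht
    obtain ⟨c, hc⟩ | ⟨P, hP, j, hrP⟩ := hIK.exists_rat_or_simpleRoot hI hr
    · exact ⟨c, hc, _, Or.inl ⟨c, rfl⟩, rfl⟩
    · obtain ⟨L, hL, hrL⟩ := h𝓓cov _ hrP
      exact ⟨r, hr, L, Or.inr (mem_biUnion hP (mem_iUnion.2 ⟨j, hL⟩)), hrL⟩

theorem exists_differentiable_section_pi {k : ℕ} {K : Set (E × (Fin k → ℝ))}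
    (hK : IsSemialgebraic K) {V : Set E} (hV : IsOpen V) (hne : V.Nonempty)
    (h : ∀ t ∈ V, ∃ r, (t, r) ∈ K) :
    ∃ V' ⊆ V, IsOpen V' ∧ V'.Nonempty ∧ ∃ σ : E → Fin k → ℝ, DifferentiableOn ℝ σ V' ∧
      ∀ t ∈ V', (t, σ t) ∈ K := by
  induction k generalizing V with
  | zero =>
    refine ⟨V, Subset.rfl, hV, hne, fun _ => 0, differentiableOn_const _, fun t ht => ?_⟩
    obtain ⟨r, hr⟩ := h t ht
    rwa [Subsingleton.elim r 0] at hr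
  | succ k ih =>
    have hKcons := hK.preimage isPolyMap_cons
    obtain ⟨V₁, hV₁, hV₁o, hV₁n, c, hc, hcs, hcK⟩ :=
      hasSemialgebraicSection hKcons.exists hV hne fun t ht => by
        obtain ⟨r, hr⟩ := h t ht
        exact ⟨r 0, Fin.tail r, by simpa using hr⟩
    have hswap : IsPolyMap fun z : (E × (Fin k → ℝ)) × ℝ => ((z.1.1, z.2), z.1.2) :=
      (isPolyMap_id.fst.fst.prodMk isPolyMap_id.snd).prodMk isPolyMap_id.fst.snd
    obtain ⟨V₂, hV₂, hV₂o, hV₂n, σ, hσ, hσK⟩ := ih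
      ((hcs.preimage hswap.fst).inter (hKcons.preimage hswap)).exists hV₁o hV₁n fun t ht => by
        obtain ⟨y, hy⟩ := hcK t ht
        exact ⟨y, c t, ⟨ht, rfl⟩, hy⟩
    refine ⟨V₂, hV₂.trans hV₁, hV₂o, hV₂n, fun t => Fin.cons (c t) (σ t),
      differentiableOn_pi.2 fun i => ?_, fun t ht => ?_⟩
    · refine Fin.cases ?_ (fun i => ?_) i
      · simpa only [Fin.cons_zero] using hc.mono hV₂
      · simpa only [Fin.cons_succ] using differentiableOn_pi.1 hσ i
    · obtain ⟨r, ⟨-, hr⟩, hrK⟩ := hσK t ht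
      obtain rfl : r = c t := hr
      exact hrK

theorem exists_differentiable_section {K : Set (E × F)} (hK : IsSemialgebraic K) {V : Set E}
    (hV : IsOpen V) (hne : V.Nonempty) (h : ∀ t ∈ V, ∃ y, (t, y) ∈ K) :
    ∃ V' ⊆ V, IsOpen V' ∧ V'.Nonempty ∧ ∃ σ : E → F, DifferentiableOn ℝ σ V' ∧
      ∀ t ∈ V', (t, σ t) ∈ K := by
  let e := (Module.finBasis ℝ F).equivFun.toContinuousLinearEquiv
  have he := hK.preimage (φ := fun z : E × (Fin (Module.finrank ℝ F) → ℝ) => (z.1, e.symm z.2))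
    (isPolyMap_id.fst.prodMk
      ((isPolyMap_linearMap e.symm.toLinearEquiv.toLinearMap).comp isPolyMap_id.snd))
  obtain ⟨V', hV', ho, hn, σ, hσ, hσK⟩ := exists_differentiable_section_pi he hV hne
    fun t ht => by
      obtain ⟨y, hy⟩ := h t ht
      exact ⟨e y, by simpa using hy⟩
  exact ⟨V', hV', ho, hn, fun t => e.symm (σ t),
    e.symm.differentiable.comp_differentiableOn hσ, hσK⟩

end Sections

/-! ### Submanifolds and their tangent spaces -/

section Submanifolds

variable {E : Type*} [NormedAddCommGroup E] [NormedSpace ℝ E]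
  {F : Type*} [NormedAddCommGroup F] [NormedSpace ℝ F]

theorem tangentVectors_mono {M N : Set E} (h : M ⊆ N) (p : E) :
    tangentVectors M p ⊆ tangentVectors N p := by
  rintro v ⟨γ, h0, hγ, hM⟩
  exact ⟨γ, h0, hγ, hM.mono fun s hs => h hs⟩

theorem hasDerivAt_add_smul (p v : E) : HasDerivAt (fun s : ℝ => p + s • v) v 0 := by
  simpa only [id_eq, one_smul] using ((hasDerivAt_id (0 : ℝ)).smul_const v).const_add p

theorem mem_tangentVectors_of_mem_nhds {M : Set E} {p : E} (hM : M ∈ 𝓝 p) (v : E) :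
    v ∈ tangentVectors M p := by
  have h0 : p + (0 : ℝ) • v = p := by rw [zero_smul, add_zero]
  exact ⟨_, h0, hasDerivAt_add_smul p v,
    (hasDerivAt_add_smul p v).continuousAt.eventually_mem (by rwa [h0])⟩

theorem hasDerivAt_comp_curve {φ : E → F} {φ' : E →L[ℝ] F} {s : Set E} {γ : ℝ → E} {v : E}
    (hφ : HasFDerivWithinAt φ φ' s (γ 0)) (hγ : HasDerivAt γ v 0)
    (hs : ∀ᶠ r in 𝓝 (0 : ℝ), γ r ∈ s) : HasDerivAt (fun r => φ (γ r)) (φ' v) 0 := by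
  have h : HasDerivWithinAt (φ ∘ γ) (φ' v) {r | γ r ∈ s} 0 :=
    hφ.comp_hasDerivWithinAt 0 hγ.hasDerivWithinAt fun r hr => hr
  exact h.hasDerivAt hs

theorem mem_tangentVectors_of_comp {φ : E → F} {φ' : E →L[ℝ] F} {s M : Set E} {N : Set F} {p v : E}
    (hφ : HasFDerivWithinAt φ φ' s p) (hM : M ⊆ s) (hMN : MapsTo φ M N)
    (hv : v ∈ tangentVectors M p) : φ' v ∈ tangentVectors N (φ p) := by
  obtain ⟨γ, rfl, hγ, hγM⟩ := hv
  exact ⟨fun r => φ (γ r), rfl, hasDerivAt_comp_curve hφ hγ (hγM.mono fun r hr => hM hr),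
    hγM.mono fun r hr => hMN hr⟩

theorem mem_tangentVectors_of_eventually_mem {φ : E → F} {φ' : E →L[ℝ] F} {N : Set F} {p : E}
    (hφ : HasFDerivAt φ φ' p) (hN : ∀ᶠ q in 𝓝 p, φ q ∈ N) (v : E) :
    φ' v ∈ tangentVectors N (φ p) :=
  mem_tangentVectors_of_comp hφ.hasFDerivWithinAt (subset_univ (φ ⁻¹' N)) (mapsTo_preimage φ N)
    (mem_tangentVectors_of_mem_nhds hN v)

theorem fderivWithin_eq_on_tangentVectors {φ ψ : E → F} {φ' ψ' : E →L[ℝ] F} {s M : Set E} {p v : E}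
    (hφ : HasFDerivWithinAt φ φ' s p) (hψ : HasFDerivWithinAt ψ ψ' s p) (hM : M ⊆ s)
    (h : ∀ᶠ q in 𝓝 p, q ∈ M → φ q = ψ q) (hv : v ∈ tangentVectors M p) : φ' v = ψ' v := by
  obtain ⟨γ, rfl, hγ, hγM⟩ := hv
  have hφγ := hasDerivAt_comp_curve hφ hγ (hγM.mono fun r hr => hM hr)
  have hψγ := hasDerivAt_comp_curve hψ hγ (hγM.mono fun r hr => hM hr)
  refine hφγ.unique (hψγ.congr_of_eventuallyEq ?_)
  filter_upwards [hγM, hγ.continuousAt.eventually h] with r hr hr'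
  exact hr' hr

/-- `f` is a local equation of `M` at `p`: a submersion at `p` whose zero set is `M` near `p`. -/
structure IsLocalEquation {k : ℕ} (M : Set E) (p : E) (f : E → Fin k → ℝ) : Prop where
  contDiffAt : ContDiffAt ℝ 1 f p
  surjective : Function.Surjective (fderiv ℝ f p)
  eventually_iff : ∀ᶠ q in 𝓝 p, (q ∈ M ↔ f q = 0)

/-- `θ` is a local diffeomorphism fixing `p` which transforms the map `f` into its differential at
`p`. It serves to flatten a submanifold with local equation `f`. -/
structure IsStraightening {k : ℕ} (f : E → Fin k → ℝ) (p : E) (θ : OpenPartialHomeomorph E E) :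
    Prop where
  mem_source : p ∈ θ.source
  apply_self : θ p = p
  contDiffAt : ContDiffAt ℝ 1 θ p
  contDiffAt_symm : ContDiffAt ℝ 1 θ.symm p
  hasFDerivAt_symm : HasFDerivAt θ.symm (ContinuousLinearMap.id ℝ E) p
  fderiv_apply_sub : ∀ q, fderiv ℝ f p (θ q - p) = f q

namespace IsStraightening

variable {k : ℕ} {M : Set E} {p : E} {f : E → Fin k → ℝ} {θ : OpenPartialHomeomorph E E}

theorem mem_target (h : IsStraightening f p θ) : p ∈ θ.target := by
  simpa only [h.apply_self] using θ.map_source h.mem_source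

theorem symm_apply_self (h : IsStraightening f p θ) : θ.symm p = p := by
  simpa only [h.apply_self] using θ.left_inv h.mem_source

theorem eventually_symm_mem_iff (h : IsStraightening f p θ) (hf : IsLocalEquation M p f) :
    ∀ᶠ q in 𝓝 p, (θ.symm q ∈ M ↔ fderiv ℝ f p (q - p) = 0) := by
  have hM := h.contDiffAt_symm.continuousAt.eventually (p := fun q => (q ∈ M ↔ f q = 0))
    (by rw [h.symm_apply_self]; exact hf.eventually_iff)
  filter_upwards [hM, θ.open_target.mem_nhds h.mem_target] with q hq hqt
  rw [hq, ← h.fderiv_apply_sub, θ.right_inv hqt]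

end IsStraightening

namespace IsLocalEquation

variable {k : ℕ} {M : Set E} {p : E} {f : E → Fin k → ℝ}

theorem hasFDerivAt (h : IsLocalEquation M p f) : HasFDerivAt f (fderiv ℝ f p) p :=
  (h.contDiffAt.differentiableAt one_ne_zero).hasFDerivAt

theorem apply_eq_zero (h : IsLocalEquation M p f) (hp : p ∈ M) : f p = 0 :=
  h.eventually_iff.self_of_nhds.1 hp

theorem fderiv_eq_zero_of_mem (h : IsLocalEquation M p f) {v : E}
    (hv : v ∈ tangentVectors M p) : fderiv ℝ f p v = 0 :=
  fderivWithin_eq_on_tangentVectors h.hasFDerivAt.hasFDerivWithinAt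
    (hasFDerivWithinAt_const (0 : Fin k → ℝ) p univ) (subset_univ M)
    (h.eventually_iff.mono fun _ hq => hq.1) hv

theorem exists_rightInverse (h : IsLocalEquation M p f) :
    ∃ R : (Fin k → ℝ) →L[ℝ] E, ∀ w, fderiv ℝ f p (R w) = w := by
  obtain ⟨R, hR⟩ := (fderiv ℝ f p).toLinearMap.exists_rightInverse_of_surjective
    (LinearMap.range_eq_top.2 h.surjective)
  exact ⟨R.toContinuousLinearMap, fun w => LinearMap.congr_fun hR w⟩

theorem exists_straightening [CompleteSpace E] (h : IsLocalEquation M p f) (hp : p ∈ M) :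
    ∃ θ, IsStraightening f p θ := by
  obtain ⟨R, hR⟩ := h.exists_rightInverse
  set f' := fderiv ℝ f p
  let g : E → E := fun q => q + R (f q - f' (q - p))
  have hgp : g p = p := by simp [g, h.apply_eq_zero hp]
  have hgc : ContDiffAt ℝ 1 g p :=
    contDiffAt_id.add (R.contDiff.contDiffAt.comp p
      (h.contDiffAt.sub (f'.contDiff.comp (contDiff_id.sub contDiff_const)).contDiffAt))
  have hgd : HasFDerivAt g ((ContinuousLinearEquiv.refl ℝ E : E ≃L[ℝ] E) : E →L[ℝ] E) p := by
    have hsub : HasFDerivAt (fun q => f q - f' (q - p)) (f' - f' ∘L .id ℝ E) p :=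
      h.hasFDerivAt.sub (f'.hasFDerivAt.comp p ((hasFDerivAt_id p).sub_const p))
    have hadd := (hasFDerivAt_id p).add (R.hasFDerivAt.comp p hsub)
    rw [ContinuousLinearMap.comp_id, sub_self, ContinuousLinearMap.comp_zero, add_zero] at hadd
    exact hadd
  let θ := hgc.toOpenPartialHomeomorph g hgd one_ne_zero
  have hθ : (θ : E → E) = g := hgc.toOpenPartialHomeomorph_coe hgd one_ne_zero
  have hsource : p ∈ θ.source := hgc.mem_toOpenPartialHomeomorph_source hgd one_ne_zero
  have hθp : θ p = p := by rw [hθ, hgp]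
  have htarget : p ∈ θ.target := by simpa only [hθp] using θ.map_source hsource
  have hsymm : θ.symm p = p := by simpa only [hθp] using θ.left_inv hsource
  rw [← hθ] at hgc hgd
  refine ⟨θ, hsource, hθp, hgc, ?_, ?_, fun q => ?_⟩
  · exact θ.contDiffAt_symm htarget (by rwa [hsymm]) (by rwa [hsymm])
  · exact θ.hasFDerivAt_symm (f' := ContinuousLinearEquiv.refl ℝ E) htarget (by rwa [hsymm])
  · rw [hθ, add_sub_right_comm, map_add, hR, add_sub_cancel]

theorem mem_tangentVectors [CompleteSpace E] (h : IsLocalEquation M p f) (hp : p ∈ M) {v : E}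
    (hv : fderiv ℝ f p v = 0) : v ∈ tangentVectors M p := by
  obtain ⟨θ, hθ⟩ := h.exists_straightening hp
  let M' : Set E := {q | θ.symm q ∈ M}
  have hline : v ∈ tangentVectors M' p := by
    have h0 : p + (0 : ℝ) • v = p := by rw [zero_smul, add_zero]
    refine ⟨_, h0, hasDerivAt_add_smul p v, ?_⟩
    filter_upwards [(hasDerivAt_add_smul p v).continuousAt.tendsto.eventually
      (by rw [h0]; exact hθ.eventually_symm_mem_iff h)] with s hs
    rw [mem_ofPred_eq, hs, add_sub_cancel_left, map_smul, hv, smul_zero]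
  simpa only [hθ.symm_apply_self, ContinuousLinearMap.id_apply] using mem_tangentVectors_of_comp
    hθ.hasFDerivAt_symm.hasFDerivWithinAt (subset_univ M') (fun q hq => hq) hline

theorem tangentVectors_eq [CompleteSpace E] (h : IsLocalEquation M p f) (hp : p ∈ M) :
    tangentVectors M p = {v | fderiv ℝ f p v = 0} :=
  Subset.antisymm (fun _ hv => h.fderiv_eq_zero_of_mem hv)
    fun _ hv => h.mem_tangentVectors hp hv

theorem exists_retraction [CompleteSpace E] (h : IsLocalEquation M p f) (hp : p ∈ M) :
    ∃ r : E → E, ContDiffAt ℝ 1 r p ∧ (∀ᶠ q in 𝓝 p, r q ∈ M) ∧ ∀ᶠ q in 𝓝 p, q ∈ M → r q = q := by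
  obtain ⟨θ, hθ⟩ := h.exists_straightening hp
  obtain ⟨R, hR⟩ := h.exists_rightInverse
  let g : E → E := fun q => θ q - R (f q)
  have hgp : g p = p := by simp [g, hθ.apply_self, h.apply_eq_zero hp]
  have hgc : ContDiffAt ℝ 1 g p := hθ.contDiffAt.sub (R.contDiff.contDiffAt.comp p h.contDiffAt)
  refine ⟨fun q => θ.symm (g q), ContDiffAt.comp p (by rw [hgp]; exact hθ.contDiffAt_symm) hgc,
    ?_, ?_⟩
  · filter_upwards [hgc.continuousAt.eventually
      (by rw [hgp]; exact hθ.eventually_symm_mem_iff h)] with q hq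
    rw [hq, sub_right_comm, map_sub, hθ.fderiv_apply_sub, hR, sub_self]
  · filter_upwards [h.eventually_iff, θ.open_source.mem_nhds hθ.mem_source] with q hq hqs hqM
    simp only [g, hq.1 hqM, map_zero, sub_zero]
    exact θ.left_inv hqs

end IsLocalEquation

theorem IsC1Submanifold.exists_localEquation {M : Set E} (h : IsC1Submanifold M) :
    ∃ k : ℕ, ∀ p ∈ M, ∃ f : E → Fin k → ℝ, IsLocalEquation M p f := by
  obtain ⟨d, k, -, h⟩ := h
  refine ⟨k, fun p hp => ?_⟩
  obtain ⟨f, hfc, hfs, hf⟩ := h p hp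
  exact ⟨f, hfc, hfs, hf⟩

theorem IsC1Submanifold.add_mem_tangentVectors [CompleteSpace E] {M : Set E}
    (h : IsC1Submanifold M) {p u v : E} (hp : p ∈ M) (hu : u ∈ tangentVectors M p)
    (hv : v ∈ tangentVectors M p) : u + v ∈ tangentVectors M p := by
  obtain ⟨k, hk⟩ := h.exists_localEquation
  obtain ⟨f, hf⟩ := hk p hp
  rw [hf.tangentVectors_eq hp, mem_ofPred_eq] at *
  rw [map_add, hu, hv, add_zero]

/-! ### Diffeomorphisms of submanifolds -/

/-- `φ` restricts to a `C¹` diffeomorphism of `S` onto itself with inverse `ψ`. -/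
structure IsDiffeoOn (S : Set E) (φ ψ : E → E) : Prop where
  contDiffOn : ContDiffOn ℝ 1 φ S
  contDiffOn_inv : ContDiffOn ℝ 1 ψ S
  bijOn : BijOn φ S S
  leftInv : ∀ x ∈ S, ψ (φ x) = x

namespace IsDiffeoOn

variable {S B : Set E} {φ ψ : E → E} {p : E}

theorem rightInv (h : IsDiffeoOn S φ ψ) : ∀ y ∈ S, φ (ψ y) = y := by
  intro y hy
  obtain ⟨x, hx, rfl⟩ := h.bijOn.surjOn hy
  rw [h.leftInv x hx]

theorem mapsTo_inv (h : IsDiffeoOn S φ ψ) : MapsTo ψ S S := by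
  intro y hy
  obtain ⟨x, hx, rfl⟩ := h.bijOn.surjOn hy
  rwa [h.leftInv x hx]

theorem hasFDerivWithinAt (h : IsDiffeoOn S φ ψ) (hp : p ∈ S) :
    HasFDerivWithinAt φ (fderivWithin ℝ φ S p) S p :=
  ((h.contDiffOn p hp).differentiableWithinAt one_ne_zero).hasFDerivWithinAt

theorem hasFDerivWithinAt_inv (h : IsDiffeoOn S φ ψ) (hp : p ∈ S) :
    HasFDerivWithinAt ψ (fderivWithin ℝ ψ S (φ p)) S (φ p) :=
  ((h.contDiffOn_inv _ (h.bijOn.mapsTo hp)).differentiableWithinAt one_ne_zero).hasFDerivWithinAt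

theorem fderivWithin_inv_apply (h : IsDiffeoOn S φ ψ) (hp : p ∈ S) {φ' : E →L[ℝ] E}
    (hφ : HasFDerivWithinAt φ φ' S p) {v : E} (hv : v ∈ tangentVectors S p) :
    fderivWithin ℝ ψ S (φ p) (φ' v) = v :=
  fderivWithin_eq_on_tangentVectors ((h.hasFDerivWithinAt_inv hp).comp p hφ h.bijOn.mapsTo)
    (hasFDerivWithinAt_id p S) Subset.rfl (Eventually.of_forall h.leftInv) hv

theorem mem_tangentVectors_preimage (h : IsDiffeoOn S φ ψ) (hp : p ∈ S) (hBS : B ⊆ S)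
    {φ' : E →L[ℝ] E} (hφ : HasFDerivWithinAt φ φ' S p) {v : E} (hv : v ∈ tangentVectors S p)
    (hvB : φ' v ∈ tangentVectors B (φ p)) : v ∈ tangentVectors {x ∈ S | φ x ∈ B} p := by
  have hmaps : MapsTo ψ B {x ∈ S | φ x ∈ B} := fun y hy =>
    ⟨h.mapsTo_inv (hBS hy), by rwa [h.rightInv y (hBS hy)]⟩
  have := mem_tangentVectors_of_comp (h.hasFDerivWithinAt_inv hp) hBS hmaps hvB
  rwa [h.fderivWithin_inv_apply hp hφ hv, h.leftInv p hp] at this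

theorem injective_fderiv_add [CompleteSpace E] {k : ℕ} {f g : E → Fin k → ℝ}
    {L : (Fin k → ℝ) →L[ℝ] E} {G : E → E} {G' : E →L[ℝ] E}
    (h : IsDiffeoOn S φ ψ) (hp : p ∈ S) (hf : IsLocalEquation S p f)
    (hg : IsLocalEquation S (φ p) g) (hL : ∀ w, fderiv ℝ g (φ p) (L w) = w)
    (hG : HasFDerivAt G G' p) (hGS : ∀ᶠ q in 𝓝 p, G q ∈ S)
    (hGφ : ∀ᶠ q in 𝓝 p, q ∈ S → G q = φ q) :
    Function.Injective (G' + L ∘L fderiv ℝ f p) := by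
  refine (injective_iff_map_eq_zero _).2 fun v hv => ?_
  replace hv : G' v + L (fderiv ℝ f p v) = 0 := hv
  have hgG : fderiv ℝ g (φ p) (G' v) = 0 := hg.fderiv_eq_zero_of_mem <| by
    simpa only [hGφ.self_of_nhds hp] using mem_tangentVectors_of_eventually_mem hG hGS v
  have hfv : fderiv ℝ f p v = 0 := by
    rw [← hL (fderiv ℝ f p v), eq_neg_of_add_eq_zero_right hv, map_neg, hgG, neg_zero]
  have hvS : v ∈ tangentVectors S p := hf.mem_tangentVectors hp hfv
  have hφv : fderivWithin ℝ φ S p v = 0 := by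
    rw [← fderivWithin_eq_on_tangentVectors hG.hasFDerivWithinAt (h.hasFDerivWithinAt hp)
      Subset.rfl hGφ hvS]
    simpa only [hfv, map_zero, add_zero] using hv
  rw [← h.fderivWithin_inv_apply hp (h.hasFDerivWithinAt hp) hvS, hφv, map_zero]

variable [FiniteDimensional ℝ E]

theorem exists_extension (h : IsDiffeoOn S φ ψ) (hS : IsC1Submanifold S) (hp : p ∈ S) :
    ∃ Φ : E → E, ContDiffAt ℝ 1 Φ p ∧ (∀ᶠ q in 𝓝 p, q ∈ S → Φ q = φ q) ∧
      ∃ A : E ≃L[ℝ] E, HasFDerivAt Φ (A : E →L[ℝ] E) p := by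
  have : CompleteSpace E := FiniteDimensional.complete ℝ E
  obtain ⟨k, hk⟩ := hS.exists_localEquation
  obtain ⟨f, hf⟩ := hk p hp
  obtain ⟨g, hg⟩ := hk (φ p) (h.bijOn.mapsTo hp)
  obtain ⟨r, hrc, hrS, hrid⟩ := hf.exists_retraction hp
  obtain ⟨L, hL⟩ := hg.exists_rightInverse
  have hφr : ContDiffAt ℝ 1 (φ ∘ r) p := by
    have hφ : ContDiffWithinAt ℝ 1 φ S (r p) := by
      rw [hrid.self_of_nhds hp]
      exact h.contDiffOn p hp
    exact (hφ.comp (s := r ⁻¹' S) p hrc.contDiffWithinAt fun q hq => hq).contDiffAt hrS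
  have hφrd : HasFDerivAt (φ ∘ r) (fderiv ℝ (φ ∘ r) p) p :=
    (hφr.differentiableAt one_ne_zero).hasFDerivAt
  have hinj := h.injective_fderiv_add hp hf hg hL hφrd
    (hrS.mono fun q hq => h.bijOn.mapsTo hq) (hrid.mono fun q hq hqS => congrArg φ (hq hqS))
  refine ⟨fun q => φ (r q) + L (f q), hφr.add (L.contDiff.contDiffAt.comp p hf.contDiffAt), ?_,
    (LinearEquiv.ofInjectiveEndo _ hinj).toContinuousLinearEquiv,
    hφrd.add (L.hasFDerivAt.comp p hf.hasFDerivAt)⟩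
  filter_upwards [hrid, hf.eventually_iff] with q hq hqf hqS
  rw [hq hqS, hqf.1 hqS, map_zero, add_zero]

theorem eventually_mem_of_extension (h : IsDiffeoOn S φ ψ) (hp : p ∈ S) {Φ : E → E}
    (hΦ : ContDiffAt ℝ 1 Φ p) (hΦφ : ∀ᶠ q in 𝓝 p, q ∈ S → Φ q = φ q) {A : E ≃L[ℝ] E}
    (hA : HasFDerivAt Φ (A : E →L[ℝ] E) p) : ∀ᶠ q in 𝓝 p, Φ q ∈ S → q ∈ S := by
  have : CompleteSpace E := FiniteDimensional.complete ℝ E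
  let θ := hΦ.toOpenPartialHomeomorph Φ hA one_ne_zero
  have hθ : (θ : E → E) = Φ := hΦ.toOpenPartialHomeomorph_coe hA one_ne_zero
  have hsource : ∀ᶠ q in 𝓝 p, q ∈ θ.source :=
    θ.open_source.mem_nhds (hΦ.mem_toOpenPartialHomeomorph_source hA one_ne_zero)
  have hψ : Tendsto ψ (𝓝[S] (Φ p)) (𝓝 p) := by
    rw [hΦφ.self_of_nhds hp]
    simpa only [h.leftInv p hp] using
      (h.contDiffOn_inv _ (h.bijOn.mapsTo hp)).continuousWithinAt.tendsto
  have hψΦ : ∀ᶠ q in 𝓝 p, Φ q ∈ S →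
      ψ (Φ q) ∈ θ.source ∧ (ψ (Φ q) ∈ S → Φ (ψ (Φ q)) = φ (ψ (Φ q))) :=
    hΦ.continuousAt.eventually (eventually_nhdsWithin_iff.1 (hψ.eventually (hsource.and hΦφ)))
  filter_upwards [hψΦ, hsource] with q hqψ hqs hqS
  obtain ⟨hψs, hψφ⟩ := hqψ hqS
  have hψS := h.mapsTo_inv hqS
  have hψq : ψ (Φ q) = q := θ.injOn hψs hqs (by rw [hθ, hψφ hψS, h.rightInv _ hqS])
  rwa [hψq] at hψS

theorem isC1Submanifold_preimage (h : IsDiffeoOn S φ ψ) (hS : IsC1Submanifold S)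
    (hB : IsC1Submanifold B) (hBS : B ⊆ S) : IsC1Submanifold {x ∈ S | φ x ∈ B} := by
  obtain ⟨d, k, hdk, hB⟩ := hB
  refine ⟨d, k, hdk, ?_⟩
  rintro p ⟨hp, hpB⟩
  obtain ⟨Φ, hΦ, hΦφ, A, hA⟩ := h.exists_extension hS hp
  obtain ⟨g, hgc, hgs, hg⟩ := hB (φ p) hpB
  rw [← hΦφ.self_of_nhds hp] at hgc hgs hg
  refine ⟨g ∘ Φ, hgc.comp p hΦ, ?_, ?_⟩
  · rw [((hgc.differentiableAt one_ne_zero).hasFDerivAt.comp p hA).fderiv]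
    exact hgs.comp A.surjective
  · filter_upwards [hΦ.continuousAt.eventually hg, hΦφ,
      h.eventually_mem_of_extension hp hΦ hΦφ hA] with q hqg hqφ hqS
    rw [Function.comp_apply, ← hqg]
    refine ⟨fun hq => ?_, fun hq => ?_⟩
    · rw [hqφ hq.1]
      exact hq.2
    · have hqS' := hqS (hBS hq)
      exact ⟨hqS', by rwa [← hqφ hqS']⟩

end IsDiffeoOn

/-! ### Transversality from a section -/

theorem hasFDerivAt_comp_prodMk {P : Type*} [NormedAddCommGroup P] [NormedSpace ℝ P] {U : Set P}
    {S : Set E} {H : P × E → F} {H' : P × E →L[ℝ] F} {σ : P → E} {σ' : P →L[ℝ] E} {t₀ : P}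
    (hH : HasFDerivWithinAt H H' (U ×ˢ S) (t₀, σ t₀)) (hσ : HasFDerivAt σ σ' t₀) (hU : U ∈ 𝓝 t₀)
    (hσS : ∀ᶠ t in 𝓝 t₀, σ t ∈ S) :
    HasFDerivAt (fun t => H (t, σ t)) (H' ∘L (ContinuousLinearMap.id ℝ P).prod σ') t₀ := by
  have h : HasFDerivWithinAt (fun t => H (t, σ t)) (H' ∘L (ContinuousLinearMap.id ℝ P).prod σ')
      (U ∩ σ ⁻¹' S) t₀ :=
    hH.comp t₀ ((hasFDerivAt_id t₀).prodMk hσ).hasFDerivWithinAt fun t ht => mk_mem_prod ht.1 ht.2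
  exact h.hasFDerivAt (inter_mem hU hσS)

/-- Differentiating `H (t, σ t) ∈ B` in a direction `τ` whose effect on `H (·, σ t₀)` is that of `w`
on `H (t₀, ·)` shows that `w + dσ τ` is tangent to the preimage of `B`, while `dσ τ` is tangent to
`A`. -/
theorem exists_add_eq_of_section {P : Type*} [NormedAddCommGroup P] [NormedSpace ℝ P]
    [CompleteSpace E] {U : Set P} {S A B : Set E} (hS : IsC1Submanifold S)
    (hAS : A ⊆ S) (hBS : B ⊆ S) {H : P × E → E} {ψ : E → E} {t₀ : P} {σ : P → E}
    (hU : U ∈ 𝓝 t₀) (hH : ContDiffOn ℝ 1 H (U ×ˢ S))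
    (hdiff : IsDiffeoOn S (fun x => H (t₀, x)) ψ)
    (hσd : DifferentiableAt ℝ σ t₀) (hσA : ∀ᶠ t in 𝓝 t₀, σ t ∈ A)
    (hσB : ∀ᶠ t in 𝓝 t₀, H (t, σ t) ∈ B)
    (hsub : tangentVectors S (H (t₀, σ t₀)) ⊆ range (fderiv ℝ (fun t => H (t, σ t₀)) t₀))
    {w : E} (hw : w ∈ tangentVectors S (σ t₀)) :
    ∃ u ∈ tangentVectors A (σ t₀),
      ∃ v ∈ tangentVectors {x ∈ S | H (t₀, x) ∈ B} (σ t₀), u + v = w := by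
  have ht₀ : t₀ ∈ U := mem_of_mem_nhds hU
  have hσS : ∀ᶠ t in 𝓝 t₀, σ t ∈ S := hσA.mono fun t ht => hAS ht
  have hx₀ : σ t₀ ∈ S := hσS.self_of_nhds
  set H' := fderivWithin ℝ H (U ×ˢ S) (t₀, σ t₀)
  have hH' : HasFDerivWithinAt H H' (U ×ˢ S) (t₀, σ t₀) :=
    ((hH _ ⟨ht₀, hx₀⟩).differentiableWithinAt one_ne_zero).hasFDerivWithinAt
  have hHx : HasFDerivWithinAt (fun x => H (t₀, x)) (H' ∘L .inr ℝ P E) S (σ t₀) :=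
    HasFDerivWithinAt.comp (t := U ×ˢ S) (σ t₀) hH'
      (hasFDerivAt_prodMk_right t₀ (σ t₀)).hasFDerivWithinAt fun x hx => mk_mem_prod ht₀ hx
  have hHt : ∀ τ, fderiv ℝ (fun t => H (t, σ t₀)) t₀ τ = H' (τ, 0) := fun τ =>
    DFunLike.congr_fun (hasFDerivAt_comp_prodMk (σ := fun _ => σ t₀) hH'
      (hasFDerivAt_const (σ t₀) t₀) hU (Eventually.of_forall fun _ => hx₀)).fderiv τ
  obtain ⟨τ, hτ⟩ := hsub (mem_tangentVectors_of_comp (φ := fun x => H (t₀, x)) hHx Subset.rfl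
    hdiff.bijOn.mapsTo hw)
  have hHτ : H' (τ, 0) = H' (0, w) := (hHt τ).symm.trans hτ
  set σ' := fderiv ℝ σ t₀
  have hσA' : ∀ τ, σ' τ ∈ tangentVectors A (σ t₀) :=
    mem_tangentVectors_of_eventually_mem hσd.hasFDerivAt hσA
  have hσB' : H' (τ, σ' τ) ∈ tangentVectors B (H (t₀, σ t₀)) :=
    mem_tangentVectors_of_eventually_mem (hasFDerivAt_comp_prodMk hH' hσd.hasFDerivAt hU hσS) hσB τ
  have hsum : H' (0, w + σ' τ) = H' (τ, σ' τ) := calc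
    H' (0, w + σ' τ) = H' (0, w) + H' (0, σ' τ) := by rw [← map_add, Prod.mk_add_mk, add_zero]
    _ = H' (τ, 0) + H' (0, σ' τ) := by rw [hHτ]
    _ = H' (τ, σ' τ) := by rw [← map_add, Prod.mk_add_mk, add_zero, zero_add]
  refine ⟨σ' (-τ), hσA' _, w + σ' τ, ?_, by rw [map_neg]; abel⟩
  exact hdiff.mem_tangentVectors_preimage hx₀ hBS hHx
    (hS.add_mem_tangentVectors hx₀ hw (tangentVectors_mono hAS _ (hσA' τ))) (by simpa [hsum])

/-! ### Semialgebraicity of tangent spaces -/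

variable [FiniteDimensional ℝ E]

/-- The limits of secants of `M` at `p`. For a submanifold these are the tangent vectors, but unlike
the definition by curves this one is a first-order formula. -/
def secantLimits (M : Set E) (p : E) : Set E :=
  {v | ∀ ε : ℝ, 0 < ε → ∃ (q : E) (c : ℝ),
    q ∈ M ∧ sqNorm (q - p) < ε ∧ sqNorm (c • (q - p) - v) < ε}

theorem tangentVectors_subset_secantLimits (M : Set E) (p : E) :
    tangentVectors M p ⊆ secantLimits M p := by
  rintro v ⟨γ, rfl, hγ, hγM⟩ ε hε
  have hnear : ∀ᶠ s in 𝓝[≠] (0 : ℝ), sqNorm (γ s - γ 0) < ε := by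
    refine nhdsWithin_le_nhds (ContinuousAt.eventually_lt ?_ continuousAt_const (by simpa))
    exact continuous_sqNorm.continuousAt.comp (hγ.continuousAt.sub continuousAt_const)
  have hslope : Tendsto (fun s : ℝ => s⁻¹ • (γ s - γ 0) - v) (𝓝[≠] 0) (𝓝 0) := by
    simpa using (hasDerivAt_iff_tendsto_slope_zero.1 hγ).sub_const v
  have hsecant : ∀ᶠ s in 𝓝[≠] (0 : ℝ), sqNorm (s⁻¹ • (γ s - γ 0) - v) < ε :=
    ((continuous_sqNorm.tendsto (0 : E)).comp hslope).eventually (by simpa using gt_mem_nhds hε)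
  obtain ⟨s, hs, hs', hsM⟩ := (hnear.and (hsecant.and (nhdsWithin_le_nhds hγM))).exists
  exact ⟨γ s, s⁻¹, hsM, hs, hs'⟩

theorem mem_closure_of_mem_secantLimits {M : Set E} {p v : E} (hv : v ∈ secantLimits M p)
    {C : Set E} (hC : ∀ (c : ℝ), ∀ w ∈ C, c • w ∈ C) (hMC : ∀ᶠ q in 𝓝 p, q ∈ M → q - p ∈ C) :
    v ∈ closure C := by
  refine mem_closure_iff_nhds.2 fun V hV => ?_
  obtain ⟨ε₁, hε₁, hV⟩ := exists_sqNorm_lt_subset hV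
  obtain ⟨ε₂, hε₂, hMC⟩ := exists_sqNorm_lt_subset hMC
  obtain ⟨q, a, hqM, hqp, hqv⟩ := hv (min ε₁ ε₂) (lt_min hε₁ hε₂)
  exact ⟨a • (q - p), hV _ (hqv.trans_le (min_le_left _ _)),
    hC a _ (hMC q (hqp.trans_le (min_le_right _ _)) hqM)⟩

theorem IsLocalEquation.fderiv_eq_zero_of_mem_secantLimits {k : ℕ} {M : Set E} {p : E}
    {f : E → Fin k → ℝ} (h : IsLocalEquation M p f) (hp : p ∈ M) {v : E}
    (hv : v ∈ secantLimits M p) : fderiv ℝ f p v = 0 := by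
  have hcone : ∀ c : ℝ, 0 < c → ‖fderiv ℝ f p v‖ ≤ c * ‖v‖ := by
    intro c hc
    have hclosed : IsClosed {w | ‖fderiv ℝ f p w‖ ≤ c * ‖w‖} :=
      isClosed_le (by fun_prop) (by fun_prop)
    rw [← mem_ofPred_eq (p := fun w => ‖fderiv ℝ f p w‖ ≤ c * ‖w‖), ← hclosed.closure_eq]
    refine mem_closure_of_mem_secantLimits hv (fun a w hw => ?_) ?_
    · rw [mem_ofPred_eq, map_smul, norm_smul, norm_smul, mul_left_comm]
      exact mul_le_mul_of_nonneg_left hw (norm_nonneg a)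
    · filter_upwards [h.hasFDerivAt.isLittleO.def hc, h.eventually_iff] with q hq hqf hqM
      rwa [hqf.1 hqM, h.apply_eq_zero hp, sub_self, zero_sub, norm_neg] at hq
  have hlim : Tendsto (fun c : ℝ => c * ‖v‖) (𝓝[>] 0) (𝓝 0) := by
    have : Continuous fun c : ℝ => c * ‖v‖ := by fun_prop
    simpa using (this.tendsto 0).mono_left nhdsWithin_le_nhds
  exact norm_le_zero_iff.1
    (ge_of_tendsto hlim (by filter_upwards [self_mem_nhdsWithin] with c hc using hcone c hc))

theorem IsC1Submanifold.tangentVectors_eq_secantLimits {M : Set E} (hM : IsC1Submanifold M) {p : E}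
    (hp : p ∈ M) : tangentVectors M p = secantLimits M p := by
  have : CompleteSpace E := FiniteDimensional.complete ℝ E
  obtain ⟨k, hk⟩ := hM.exists_localEquation
  obtain ⟨f, hf⟩ := hk p hp
  exact Subset.antisymm (tangentVectors_subset_secantLimits M p) fun v hv =>
    hf.mem_tangentVectors hp (hf.fderiv_eq_zero_of_mem_secantLimits hp hv)

theorem isSemialgebraic_secantLimits {D : Set (F × E)} (hD : IsSemialgebraic D) :
    IsSemialgebraic {z : F × E × E | z.2.2 ∈ secantLimits {q | (z.1, q) ∈ D} z.2.1} := by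
  have hbody : IsSemialgebraic {y : (((F × E × E) × ℝ) × E) × ℝ |
      (y.1.1.1.1, y.1.2) ∈ D ∧ sqNorm (y.1.2 - y.1.1.1.2.1) < y.1.1.2 ∧
        sqNorm (y.2 • (y.1.2 - y.1.1.1.2.1) - y.1.1.1.2.2) < y.1.1.2} := by
    have i := isPolyMap_id (E := (((F × E × E) × ℝ) × E) × ℝ)
    refine (hD.preimage (i.fst.fst.fst.fst.prodMk i.fst.snd)).and
      ((isSemialgebraic_lt (isPolyMap_sqNorm.comp (i.fst.snd.sub i.fst.fst.fst.snd.fst))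
        i.fst.fst.snd).and
      (isSemialgebraic_lt (isPolyMap_sqNorm.comp
        ((i.snd.smul (i.fst.snd.sub i.fst.fst.fst.snd.fst)).sub i.fst.fst.fst.snd.snd))
        i.fst.fst.snd))
  have hpos : IsSemialgebraic {y : (F × E × E) × ℝ | 0 < y.2} :=
    isSemialgebraic_lt (isPolyMap_const 0) isPolyMap_id.snd
  exact (hpos.imp hbody.exists.exists).forall

end Submanifolds

/-! ### Strata in projective space -/

section Strata

variable {𝕜 : Type*} [RCLike 𝕜] {n : ℕ}

theorem continuousOn_lineMatrix :
    ContinuousOn (lineMatrix : (Fin (n + 1) → 𝕜) → MatSpace 𝕜 n) {v | v ≠ 0} := by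
  refine continuousOn_pi.2 fun i => continuousOn_pi.2 fun j => ?_
  unfold lineMatrix
  refine ContinuousOn.div (Continuous.continuousOn ?_) (Continuous.continuousOn ?_) fun v hv => ?_
  · exact (continuous_apply i).mul (RCLike.continuous_conj.comp (continuous_apply j))
  · exact RCLike.continuous_ofReal.comp
      (continuous_finsetSum _ fun k _ => ((continuous_apply k).norm.pow 2))
  · exact_mod_cast (sum_norm_sq_pos hv).ne'

theorem exists_isCompact_range_projEmb_subset :
    ∃ K : Set (MatSpace 𝕜 n), IsCompact K ∧ range (projEmb : ProjSpace 𝕜 n → _) ⊆ K := by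
  refine ⟨lineMatrix '' Metric.sphere (0 : Fin (n + 1) → 𝕜) 1,
    (isCompact_sphere _ _).image_of_continuousOn (continuousOn_lineMatrix.mono fun v hv => ?_), ?_⟩
  · exact ne_zero_of_mem_unit_sphere ⟨v, hv⟩
  · rintro _ ⟨x, rfl⟩
    induction x using Projectivization.ind with
    | h v hv =>
    have hv' : ‖v‖ ≠ 0 := norm_ne_zero_iff.2 hv
    refine ⟨((‖v‖⁻¹ : ℝ) : 𝕜) • v, ?_, ?_⟩
    · rw [mem_sphere_zero_iff_norm, norm_smul, RCLike.norm_ofReal, abs_inv, abs_norm,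
        inv_mul_cancel₀ hv']
    · rw [projEmb_mk, lineMatrix_smul _ (by simpa using hv')]

theorem IsStratification.finite {𝒮 : Set (Set (ProjSpace 𝕜 n))} {X : Set (ProjSpace 𝕜 n)}
    (h : IsStratification 𝒮 X) : 𝒮.Finite := by
  obtain ⟨K, hK, hrange⟩ := exists_isCompact_range_projEmb_subset (𝕜 := 𝕜) (n := n)
  have hmeet : {S : 𝒮 | ((projEmb '' (S : Set (ProjSpace 𝕜 n))) ∩ K).Nonempty} = univ := by
    refine eq_univ_of_forall fun S => ?_
    obtain ⟨x, hx⟩ := h.nonempty S S.2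
    exact ⟨projEmb x, mem_image_of_mem _ hx, hrange (mem_range_self x)⟩
  have hfin := h.locallyFinite.finite_nonempty_inter_compact hK
  rw [hmeet] at hfin
  exact finite_coe_iff.1 (finite_univ_iff.1 hfin)

/-- The submanifolds `A` and `B` of `S` are transverse in `S` at `x`. -/
def TransverseAt (S A B : Set (ProjSpace 𝕜 n)) (x : ProjSpace 𝕜 n) : Prop :=
  ∀ w ∈ tangentAt S x, ∃ u ∈ tangentAt A x, ∃ v ∈ tangentAt B x, u + v = w

section TransverseAt

variable {S A B : Set (ProjSpace 𝕜 n)}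

theorem tangentAt_mono {M N : Set (ProjSpace 𝕜 n)} (h : M ⊆ N) (x : ProjSpace 𝕜 n) :
    tangentAt M x ⊆ tangentAt N x :=
  tangentVectors_mono (image_mono h) _

theorem transverseIn_of_transverseAt (hS : IsC1Submanifold (projEmb '' S)) (hAS : A ⊆ S)
    (hBS : B ⊆ S) (h : ∀ x ∈ A ∩ B, TransverseAt S A B x) : TransverseIn S A B := by
  refine fun x hx => Subset.antisymm ?_ (h x hx)
  rintro _ ⟨u, hu, v, hv, rfl⟩
  exact hS.add_mem_tangentVectors (mem_image_of_mem _ (hAS hx.1)) (tangentAt_mono hAS x hu)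
    (tangentAt_mono hBS x hv)

theorem transverseAt_iff_secantLimits (hS : IsC1Submanifold (projEmb '' S))
    (hA : IsC1Submanifold (projEmb '' A)) (hB : IsC1Submanifold (projEmb '' B))
    {x : ProjSpace 𝕜 n} (hxS : x ∈ S) (hxA : x ∈ A) (hxB : x ∈ B) :
    TransverseAt S A B x ↔ ∀ w, w ∈ secantLimits (projEmb '' S) (projEmb x) →
      ∃ u, u ∈ secantLimits (projEmb '' A) (projEmb x) ∧
        w - u ∈ secantLimits (projEmb '' B) (projEmb x) := by
  simp only [TransverseAt, tangentAt, hS.tangentVectors_eq_secantLimits (mem_image_of_mem _ hxS),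
    hA.tangentVectors_eq_secantLimits (mem_image_of_mem _ hxA),
    hB.tangentVectors_eq_secantLimits (mem_image_of_mem _ hxB), ← eq_sub_iff_add_eq',
    exists_eq_right]

end TransverseAt

/-! ### Preimages of strata under a stratified submersive family -/

variable {m : ℕ} {U : Set (Fin m → 𝕜)} {𝒮 : Set (Set (ProjSpace 𝕜 n))}
  {Ψ : (Fin m → 𝕜) → ProjSpace 𝕜 n → ProjSpace 𝕜 n} {S A B : Set (ProjSpace 𝕜 n)}
  {t : Fin m → 𝕜}

theorem IsStratifiedSubmersiveFamily.preimage_subset (h𝒮 : IsStratification 𝒮 univ)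
    (hΨ : IsStratifiedSubmersiveFamily U 𝒮 Ψ) (ht : t ∈ U) (hS : S ∈ 𝒮) (hBS : B ⊆ S) :
    Ψ t ⁻¹' B ⊆ S := by
  intro x hx
  obtain ⟨S', hS', hxS'⟩ : x ∈ ⋃₀ 𝒮 := by rw [h𝒮.sUnion_eq]; exact mem_univ x
  rwa [h𝒮.disjoint.elim_set hS hS' _ (hBS hx) (((hΨ S' hS').bijOn t ht).mapsTo hxS')]

theorem IsSubmersiveFamily.exists_isDiffeoOn (h : IsSubmersiveFamily U S Ψ) :
    ∃ H : (Fin m → 𝕜) × MatSpace 𝕜 n → MatSpace 𝕜 n,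
      ContDiffOn ℝ 1 H (U ×ˢ (projEmb '' S)) ∧
      (∀ t ∈ U, ∀ x ∈ S, H (t, projEmb x) = projEmb (Ψ t x)) ∧
      ∀ t ∈ U, ∃ G, IsDiffeoOn (projEmb '' S) (fun x => H (t, x)) G := by
  obtain ⟨H, hH, hHΨ⟩ := h.smooth
  refine ⟨H, hH, hHΨ, fun t ht => ?_⟩
  obtain ⟨G, hG, hGΨ⟩ := h.smooth_inv t ht
  have hbij := h.bijOn t ht
  refine ⟨G, hH.comp (contDiff_prodMk_right t).contDiffOn fun x hx => mk_mem_prod ht hx, hG,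
    ⟨?_, ?_, ?_⟩, ?_⟩
  · rintro _ ⟨x, hx, rfl⟩
    exact ⟨Ψ t x, hbij.mapsTo hx, (hHΨ t ht x hx).symm⟩
  · rintro _ ⟨x, hx, rfl⟩ _ ⟨y, hy, rfl⟩ hxy
    simp only [hHΨ t ht x hx, hHΨ t ht y hy] at hxy
    rw [hbij.injOn hx hy (projEmb_injective hxy)]
  · rintro _ ⟨y, hy, rfl⟩
    obtain ⟨x, hx, rfl⟩ := hbij.surjOn hy
    exact ⟨projEmb x, mem_image_of_mem _ hx, hHΨ t ht x hx⟩
  · rintro _ ⟨x, hx, rfl⟩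
    simp only [hHΨ t ht x hx]
    exact hGΨ x hx

theorem IsStratifiedSubmersiveFamily.image_preimage (h𝒮 : IsStratification 𝒮 univ)
    (hΨ : IsStratifiedSubmersiveFamily U 𝒮 Ψ) (ht : t ∈ U) (hS : S ∈ 𝒮) (hBS : B ⊆ S)
    {H : (Fin m → 𝕜) × MatSpace 𝕜 n → MatSpace 𝕜 n}
    (hH : ∀ t ∈ U, ∀ x ∈ S, H (t, projEmb x) = projEmb (Ψ t x)) :
    projEmb '' (Ψ t ⁻¹' B) = {x ∈ projEmb '' S | H (t, x) ∈ projEmb '' B} := by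
  ext z
  constructor
  · rintro ⟨x, hx, rfl⟩
    have hxS := hΨ.preimage_subset h𝒮 ht hS hBS hx
    refine ⟨mem_image_of_mem _ hxS, ?_⟩
    rw [hH t ht x hxS]
    exact mem_image_of_mem _ hx
  · rintro ⟨⟨x, hx, rfl⟩, hB⟩
    rw [hH t ht x hx, projEmb_injective.mem_set_image] at hB
    exact mem_image_of_mem _ hB

theorem IsStratifiedSubmersiveFamily.isC1Submanifold_preimage (h𝒮 : IsStratification 𝒮 univ)
    (hΨ : IsStratifiedSubmersiveFamily U 𝒮 Ψ) (ht : t ∈ U) (hS : S ∈ 𝒮) (hBS : B ⊆ S)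
    (hB : IsC1Submanifold (projEmb '' B)) : IsC1Submanifold (projEmb '' (Ψ t ⁻¹' B)) := by
  obtain ⟨H, -, hHΨ, hdiff⟩ := (hΨ S hS).exists_isDiffeoOn
  obtain ⟨G, hG⟩ := hdiff t ht
  rw [hΨ.image_preimage h𝒮 ht hS hBS hHΨ]
  exact hG.isC1Submanifold_preimage (h𝒮.stratum_submanifold S hS) hB (image_mono hBS)

/-- The set of all `(t, x)` such that `Ψ t` maps `x` into `B`. It presents the preimages of `B` as
the fibres of a single semialgebraic set. -/
def preimageFamily (U : Set (Fin m → 𝕜)) (Ψ : (Fin m → 𝕜) → ProjSpace 𝕜 n → ProjSpace 𝕜 n)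
    (B : Set (ProjSpace 𝕜 n)) : Set ((Fin m → 𝕜) × MatSpace 𝕜 n) :=
  {z | z.1 ∈ U ∧ z.2 ∈ projEmb '' (Ψ z.1 ⁻¹' B)}

theorem setOf_mem_preimageFamily (ht : t ∈ U) :
    {q | (t, q) ∈ preimageFamily U Ψ B} = projEmb '' (Ψ t ⁻¹' B) :=
  Subset.antisymm (fun _ hq => hq.2) fun _ hq => ⟨ht, hq⟩

theorem isSemialgebraic_preimageFamily (hΨ : IsSemialgebraicFamily U Ψ)
    (hB : IsSemialgebraic (projEmb '' B)) : IsSemialgebraic (preimageFamily U Ψ B) := by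
  have i := isPolyMap_id (E := ((Fin m → 𝕜) × MatSpace 𝕜 n) × MatSpace 𝕜 n)
  convert ((hΨ.preimage (i.fst.fst.prodMk (i.fst.snd.prodMk i.snd))).inter
    (hB.preimage i.snd)).exists using 1
  ext ⟨t, z⟩
  constructor
  · rintro ⟨ht, x, hx, rfl⟩
    exact ⟨projEmb (Ψ t x), ⟨ht, x, rfl, rfl⟩, mem_image_of_mem _ hx⟩
  · rintro ⟨y, ⟨ht, x, hx, hy⟩, hyB⟩
    simp only at hx hy ht hyB
    rw [mem_preimage, hy, projEmb_injective.mem_set_image] at hyB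
    exact ⟨ht, x, hyB, hx.symm⟩

theorem isSemialgebraic_image_preimage (hΨ : IsSemialgebraicFamily U Ψ)
    (hB : IsSemialgebraic (projEmb '' B)) (ht : t ∈ U) :
    IsSemialgebraic (projEmb '' (Ψ t ⁻¹' B)) := by
  rw [← setOf_mem_preimageFamily ht]
  exact (isSemialgebraic_preimageFamily hΨ hB).preimage
    ((isPolyMap_const t).prodMk (isPolyMap_id (E := MatSpace 𝕜 n)))

section Substratified

variable {W : Set (ProjSpace 𝕜 n)} {ℬ : Set (Set (ProjSpace 𝕜 n))}

theorem IsSubstratified.exists_mem_preimage (hΨ : IsStratifiedSubmersiveFamily U 𝒮 Ψ)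
    (hℬ : IsSubstratified univ 𝒮 W ℬ) (ht : t ∈ U) (hB : B ∈ ℬ) :
    ∃ S ∈ 𝒮, B ⊆ S ∧ ∃ x ∈ S, Ψ t x ∈ B := by
  obtain ⟨S, hS, hBS⟩ := hℬ.exists_stratum B hB
  obtain ⟨y, hy⟩ := hℬ.stratification.nonempty B hB
  obtain ⟨x, hx, rfl⟩ := ((hΨ S hS).bijOn t ht).surjOn (hBS hy)
  exact ⟨S, hS, hBS, x, hx, hy⟩

theorem IsSubstratified.subset_of_preimage_subset (h𝒮 : IsStratification 𝒮 univ)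
    (hΨ : IsStratifiedSubmersiveFamily U 𝒮 Ψ) (hℬ : IsSubstratified univ 𝒮 W ℬ) (ht : t ∈ U)
    (hB : B ∈ ℬ) (hS : S ∈ 𝒮) (h : Ψ t ⁻¹' B ⊆ S) : B ⊆ S := by
  obtain ⟨S', hS', hBS', x, hxS', hxB⟩ := hℬ.exists_mem_preimage hΨ ht hB
  rwa [h𝒮.disjoint.elim_set hS hS' x (h hxB) hxS']

theorem IsSubstratified.isStratification_preimage (h𝒮 : IsStratification 𝒮 univ)
    (hΨs : IsSemialgebraicFamily U Ψ) (hΨ : IsStratifiedSubmersiveFamily U 𝒮 Ψ)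
    (hℬ : IsSubstratified univ 𝒮 W ℬ) (ht : t ∈ U) :
    IsStratification ((fun B => Ψ t ⁻¹' B) '' ℬ) (Ψ t ⁻¹' W) where
  semialgebraic := isSemialgebraic_image_preimage hΨs hℬ.stratification.semialgebraic ht
  nonempty := by
    rintro _ ⟨B, hB, rfl⟩
    obtain ⟨-, -, -, x, -, hx⟩ := hℬ.exists_mem_preimage hΨ ht hB
    exact ⟨x, hx⟩
  disjoint := by
    rintro _ ⟨B, hB, rfl⟩ _ ⟨B', hB', rfl⟩ hne
    exact (hℬ.stratification.disjoint hB hB' fun h => hne (by rw [h])).preimage (Ψ t)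
  sUnion_eq := by rw [← hℬ.stratification.sUnion_eq, sUnion_image, preimage_sUnion]
  locallyFinite := by
    have : Finite ((fun B => Ψ t ⁻¹' B) '' ℬ) := hℬ.stratification.finite.image _
    exact locallyFinite_of_finite _
  stratum_semialgebraic := by
    rintro _ ⟨B, hB, rfl⟩
    exact isSemialgebraic_image_preimage hΨs (hℬ.stratification.stratum_semialgebraic B hB) ht
  stratum_submanifold := by
    rintro _ ⟨B, hB, rfl⟩
    obtain ⟨S, hS, hBS⟩ := hℬ.exists_stratum B hB
    exact hΨ.isC1Submanifold_preimage h𝒮 ht hS hBS (hℬ.stratification.stratum_submanifold B hB)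

theorem IsSubstratified.preimage (h𝒮 : IsStratification 𝒮 univ)
    (hΨs : IsSemialgebraicFamily U Ψ) (hΨ : IsStratifiedSubmersiveFamily U 𝒮 Ψ)
    (hℬ : IsSubstratified univ 𝒮 W ℬ) (ht : t ∈ U) :
    IsSubstratified univ 𝒮 (Ψ t ⁻¹' W) ((fun B => Ψ t ⁻¹' B) '' ℬ) where
  subset := subset_univ _
  stratification := hℬ.isStratification_preimage h𝒮 hΨs hΨ ht
  exists_stratum := by
    rintro _ ⟨B, hB, rfl⟩
    obtain ⟨S, hS, hBS⟩ := hℬ.exists_stratum B hB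
    exact ⟨S, hS, hΨ.preimage_subset h𝒮 ht hS hBS⟩

end Substratified

/-! ### The points of non-transversality -/

/-- The set of all `(t, x)` such that `A` and the preimage of `B` under `Ψ t` meet at `x` and
are not transverse in `S` there. Its projection is the set of parameters to be avoided. -/
def nontransverseSet (U : Set (Fin m → 𝕜)) (Ψ : (Fin m → 𝕜) → ProjSpace 𝕜 n → ProjSpace 𝕜 n)
    (S A B : Set (ProjSpace 𝕜 n)) : Set ((Fin m → 𝕜) × MatSpace 𝕜 n) :=
  {z | z.1 ∈ U ∧ ∃ x ∈ A ∩ Ψ z.1 ⁻¹' B, projEmb x = z.2 ∧ ¬ TransverseAt S A (Ψ z.1 ⁻¹' B) x}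

theorem mem_nontransverseSet_iff_secantLimits (h𝒮 : IsStratification 𝒮 univ)
    (hΨ : IsStratifiedSubmersiveFamily U 𝒮 Ψ) (hS : S ∈ 𝒮) (hAS : A ⊆ S) (hBS : B ⊆ S)
    (hA : IsC1Submanifold (projEmb '' A)) (hB : IsC1Submanifold (projEmb '' B))
    (z : (Fin m → 𝕜) × MatSpace 𝕜 n) :
    z ∈ nontransverseSet U Ψ S A B ↔ (z.2 ∈ projEmb '' A ∧ z ∈ preimageFamily U Ψ B) ∧
      ¬ ∀ w, w ∈ secantLimits (projEmb '' S) z.2 →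
        ∃ u, u ∈ secantLimits (projEmb '' A) z.2 ∧
          w - u ∈ secantLimits {q | (z.1, q) ∈ preimageFamily U Ψ B} z.2 := by
  obtain ⟨t, z⟩ := z
  have htransverse (ht : t ∈ U) {x : ProjSpace 𝕜 n} (hxA : x ∈ A) (hxB : x ∈ Ψ t ⁻¹' B) :=
    transverseAt_iff_secantLimits (h𝒮.stratum_submanifold S hS) hA
      (hΨ.isC1Submanifold_preimage h𝒮 ht hS hBS hB) (hAS hxA) hxA hxB
  constructor
  · rintro ⟨ht, x, ⟨hxA, hxB⟩, rfl, hx⟩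
    rw [htransverse ht hxA hxB, ← setOf_mem_preimageFamily ht] at hx
    exact ⟨⟨mem_image_of_mem _ hxA, ht, mem_image_of_mem _ hxB⟩, hx⟩
  · rintro ⟨⟨⟨x, hxA, rfl⟩, ht, hxB⟩, hx⟩
    replace hxB := projEmb_injective.mem_set_image.1 hxB
    rw [setOf_mem_preimageFamily ht] at hx
    exact ⟨ht, x, ⟨hxA, hxB⟩, rfl, fun h => hx ((htransverse ht hxA hxB).1 h)⟩

theorem isSemialgebraic_nontransverseSet (h𝒮 : IsStratification 𝒮 univ)
    (hΨs : IsSemialgebraicFamily U Ψ) (hΨ : IsStratifiedSubmersiveFamily U 𝒮 Ψ)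
    (hS : S ∈ 𝒮) (hAS : A ⊆ S) (hBS : B ⊆ S)
    (hA : IsC1Submanifold (projEmb '' A)) (hB : IsC1Submanifold (projEmb '' B))
    (hAs : IsSemialgebraic (projEmb '' A)) (hBs : IsSemialgebraic (projEmb '' B)) :
    IsSemialgebraic (nontransverseSet U Ψ S A B) := by
  have hB' := isSemialgebraic_preimageFamily hΨs hBs
  have i := isPolyMap_id (E := (Fin m → 𝕜) × MatSpace 𝕜 n)
  have j := isPolyMap_id (E := ((Fin m → 𝕜) × MatSpace 𝕜 n) × MatSpace 𝕜 n)
  have k := isPolyMap_id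
    (E := (((Fin m → 𝕜) × MatSpace 𝕜 n) × MatSpace 𝕜 n) × MatSpace 𝕜 n)
  have htangent {C : Set (ProjSpace 𝕜 n)} (hC : IsSemialgebraic (projEmb '' C)) :
      IsSemialgebraic {z : (Fin m → 𝕜) × MatSpace 𝕜 n × MatSpace 𝕜 n |
        z.2.2 ∈ secantLimits (projEmb '' C) z.2.1} :=
    isSemialgebraic_secantLimits (hC.preimage i.snd)
  have hTS := (htangent (h𝒮.stratum_semialgebraic S hS)).preimage
    (j.fst.fst.prodMk (j.fst.snd.prodMk j.snd))
  have hTA := (htangent hAs).preimage (k.fst.fst.fst.prodMk (k.fst.fst.snd.prodMk k.snd))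
  have hTB := (isSemialgebraic_secantLimits hB').preimage
    (k.fst.fst.fst.prodMk (k.fst.fst.snd.prodMk (k.fst.snd.sub k.snd)))
  rw [Set.ext (mem_nontransverseSet_iff_secantLimits h𝒮 hΨ hS hAS hBS hA hB)]
  exact ((hAs.preimage i.snd).inter hB').and (hTS.imp (hTA.inter hTB).exists).forall.not

theorem IsSubmersiveFamily.tangentAt_subset_range_fderiv (h : IsSubmersiveFamily U S Ψ)
    (hU : U ∈ 𝓝 t) {H : (Fin m → 𝕜) × MatSpace 𝕜 n → MatSpace 𝕜 n}
    (hH : ∀ t ∈ U, ∀ x ∈ S, H (t, projEmb x) = projEmb (Ψ t x)) {x : ProjSpace 𝕜 n} (hx : x ∈ S) :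
    tangentAt S (Ψ t x) ⊆ range (fderiv ℝ (fun s => H (s, projEmb x)) t) := by
  have heq : (fun s => H (s, projEmb x)) =ᶠ[𝓝 t] fun s => projEmb (Ψ s x) :=
    mem_of_superset hU fun s hs => hH s hs x hx
  rw [heq.fderiv_eq, h.submersive t (mem_of_mem_nhds hU) x hx]

theorem transverseAt_of_section (h𝒮 : IsStratification 𝒮 univ)
    (hΨ : IsStratifiedSubmersiveFamily U 𝒮 Ψ) (hS : S ∈ 𝒮) (hAS : A ⊆ S) (hBS : B ⊆ S)
    (hU : U ∈ 𝓝 t) {σ : (Fin m → 𝕜) → MatSpace 𝕜 n} (hσ : DifferentiableAt ℝ σ t)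
    (hσA : ∀ᶠ s in 𝓝 t, σ s ∈ projEmb '' A)
    (hσB : ∀ᶠ s in 𝓝 t, σ s ∈ projEmb '' (Ψ s ⁻¹' B)) {x : ProjSpace 𝕜 n} (hx : projEmb x = σ t) :
    TransverseAt S A (Ψ t ⁻¹' B) x := by
  have ht : t ∈ U := mem_of_mem_nhds hU
  have hxS : x ∈ S := hAS (projEmb_injective.mem_set_image.1 (hx ▸ hσA.self_of_nhds))
  obtain ⟨H, hH, hHΨ, hdiff⟩ := (hΨ S hS).exists_isDiffeoOn
  obtain ⟨G, hG⟩ := hdiff t ht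
  have hHB : ∀ᶠ s in 𝓝 t, H (s, σ s) ∈ projEmb '' B := by
    filter_upwards [hσB, hU] with s hs hsU
    rw [hΨ.image_preimage h𝒮 hsU hS hBS hHΨ] at hs
    exact hs.2
  have hsub : tangentVectors (projEmb '' S) (H (t, σ t)) ⊆
      range (fderiv ℝ (fun s => H (s, σ t)) t) := by
    rw [← hx, hHΨ t ht x hxS]
    exact (hΨ S hS).tangentAt_subset_range_fderiv hU hHΨ hxS
  unfold TransverseAt tangentAt
  rw [hΨ.image_preimage h𝒮 ht hS hBS hHΨ, hx]
  exact fun w => exists_add_eq_of_section (h𝒮.stratum_submanifold S hS) (image_mono hAS)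
    (image_mono hBS) hU hH hG hσ hσA hHB hsub

/-- Otherwise a differentiable choice of points of non-transversality exists on an open set of
parameters, and the existence of such a choice forces transversality. -/
theorem interior_setOf_exists_mem_nontransverseSet (h𝒮 : IsStratification 𝒮 univ) (hU : IsOpen U)
    (hΨ : IsStratifiedSubmersiveFamily U 𝒮 Ψ) (hS : S ∈ 𝒮) (hAS : A ⊆ S) (hBS : B ⊆ S)
    (hK : IsSemialgebraic (nontransverseSet U Ψ S A B)) :
    interior {t | ∃ z, (t, z) ∈ nontransverseSet U Ψ S A B} = ∅ := by
  by_contra hne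
  obtain ⟨V, -, hVo, ⟨t, ht⟩, σ, hσ, hσK⟩ := exists_differentiable_section hK isOpen_interior
    (nonempty_iff_ne_empty.2 hne)
    fun t ht => (interior_subset ht : t ∈ {t | ∃ z, (t, z) ∈ nontransverseSet U Ψ S A B})
  have hV : V ∈ 𝓝 t := hVo.mem_nhds ht
  have hσAB : ∀ᶠ s in 𝓝 t, σ s ∈ projEmb '' A ∧ σ s ∈ projEmb '' (Ψ s ⁻¹' B) := by
    filter_upwards [hV] with s hs
    obtain ⟨-, x, ⟨hxA, hxB⟩, hx, -⟩ := hσK s hs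
    exact ⟨⟨x, hxA, hx⟩, x, hxB, hx⟩
  obtain ⟨htU, x, -, hx, hnot⟩ := hσK t ht
  exact hnot (transverseAt_of_section h𝒮 hΨ hS hAS hBS (hU.mem_nhds htU) (hσ.differentiableAt hV)
    (hσAB.mono fun _ h => h.1) (hσAB.mono fun _ h => h.2) hx)

theorem exists_ne_zero_transverseIn_preimage (h𝒮 : IsStratification 𝒮 univ) (hU : IsOpen U)
    (hΨs : IsSemialgebraicFamily U Ψ) (hΨ : IsStratifiedSubmersiveFamily U 𝒮 Ψ)
    (hS : S ∈ 𝒮) (hAS : A ⊆ S) (hBS : B ⊆ S)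
    (hA : IsC1Submanifold (projEmb '' A)) (hB : IsC1Submanifold (projEmb '' B))
    (hAs : IsSemialgebraic (projEmb '' A)) (hBs : IsSemialgebraic (projEmb '' B)) :
    ∃ q ∈ realPolyFunctions (Fin m → 𝕜), q ≠ 0 ∧
      ∀ t ∈ U, q t ≠ 0 → TransverseIn S A (Ψ t ⁻¹' B) := by
  have hK := isSemialgebraic_nontransverseSet h𝒮 hΨs hΨ hS hAS hBS hA hB hAs hBs
  obtain ⟨q, hq, hq0, h⟩ := hK.exists.exists_ne_zero_eq_zero_of_notMem_interior
  rw [interior_setOf_exists_mem_nontransverseSet h𝒮 hU hΨ hS hAS hBS hK] at h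
  refine ⟨q, hq, hq0, fun t ht hqt => transverseIn_of_transverseAt (h𝒮.stratum_submanifold S hS)
    hAS (hΨ.preimage_subset h𝒮 ht hS hBS) fun x hx => ?_⟩
  by_contra hnot
  exact hqt (h t ⟨projEmb x, ht, x, hx, rfl, hnot⟩ (notMem_empty t))

end Strata

theorem mainTheorem2_general {𝕜 : Type*} [RCLike 𝕜] {n m : ℕ}
    {𝒮 : Set (Set (ProjSpace 𝕜 n))} (h𝒮 : IsStratification 𝒮 univ)
    {U : Set (Fin m → 𝕜)} (hU : IsOpen U)
    {Ψ : (Fin m → 𝕜) → ProjSpace 𝕜 n → ProjSpace 𝕜 n}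
    (hΨs : IsSemialgebraicFamily U Ψ) (hΨ : IsStratifiedSubmersiveFamily U 𝒮 Ψ)
    {Z W : Set (ProjSpace 𝕜 n)} {𝒜 ℬ : Set (Set (ProjSpace 𝕜 n))}
    (h𝒜 : IsSubstratified univ 𝒮 Z 𝒜) (hℬ : IsSubstratified univ 𝒮 W ℬ) :
    ∃ q ∈ realPolyFunctions (Fin m → 𝕜), q ≠ 0 ∧ ∀ t ∈ U, q t ≠ 0 →
      StratifiedTransverse univ 𝒮 Z 𝒜 (Ψ t ⁻¹' W) ((fun B => Ψ t ⁻¹' B) '' ℬ) := by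
  let I := {i ∈ 𝒮 ×ˢ 𝒜 ×ˢ ℬ | i.2.1 ⊆ i.1 ∧ i.2.2 ⊆ i.1}
  have hI : I.Finite := (h𝒮.finite.prod
    (h𝒜.stratification.finite.prod hℬ.stratification.finite)).subset (sep_subset _ _)
  have hpoly : ∀ i ∈ I, ∃ p ∈ realPolyFunctions (Fin m → 𝕜), p ≠ 0 ∧
      ∀ t ∈ U, p t ≠ 0 → TransverseIn i.1 i.2.1 (Ψ t ⁻¹' i.2.2) := by
    rintro ⟨S, A, B⟩ ⟨⟨hS, hA, hB⟩, hAS, hBS⟩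
    exact exists_ne_zero_transverseIn_preimage h𝒮 hU hΨs hΨ hS hAS hBS
      (h𝒜.stratification.stratum_submanifold A hA) (hℬ.stratification.stratum_submanifold B hB)
      (h𝒜.stratification.stratum_semialgebraic A hA) (hℬ.stratification.stratum_semialgebraic B hB)
  choose! p hp hp0 hpT using hpoly
  obtain ⟨q, hq, hq0, hqp⟩ := exists_ne_zero_forall_eq_zero_of_finite (hI.image p)
    (image_subset_iff.2 hp) (forall_mem_image.2 hp0)
  refine ⟨q, hq, hq0, fun t ht hqt => ⟨h𝒜, hℬ.preimage h𝒮 hΨs hΨ ht, ?_⟩⟩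
  rintro S hS A hA _ ⟨B, hB, rfl⟩ hAS hBS
  have hi : (S, A, B) ∈ I :=
    ⟨⟨hS, hA, hB⟩, hAS, hℬ.subset_of_preimage_subset h𝒮 hΨ ht hB hS hBS⟩
  exact hpT _ hi t ht fun hpt => hqt (hqp _ (mem_image_of_mem p hi) t hpt)

theorem mainTheorem2 {𝕜 : Type*} [RCLike 𝕜] (n : ℕ)
    (𝒮 : Set (Set (ProjSpace 𝕜 n))) (h𝒮 : IsStratification 𝒮 univ)
    (U : Set (Fin (n + 1) → 𝕜)) (hUo : IsOpen U) (hUs : IsSemialgebraic U)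
    (Ψ : (Fin (n + 1) → 𝕜) → ProjSpace 𝕜 n → ProjSpace 𝕜 n)
    (hΨs : IsSemialgebraicFamily U Ψ)
    (hΨ : IsStratifiedSubmersiveFamily U 𝒮 Ψ)
    (Z W : Set (ProjSpace 𝕜 n)) (𝒜 ℬ : Set (Set (ProjSpace 𝕜 n)))
    (h𝒜 : IsSubstratified univ 𝒮 Z 𝒜) (hℬ : IsSubstratified univ 𝒮 W ℬ) :
    ∃ U' : Set (Fin (n + 1) → 𝕜), U' ⊆ U ∧ IsOpen U' ∧ U ⊆ closure U' ∧ IsSemialgebraic U' ∧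
      ∀ t ∈ U', StratifiedTransverse univ 𝒮 Z 𝒜
        (Ψ t ⁻¹' W) ((fun B => Ψ t ⁻¹' B) '' ℬ) := by
  obtain ⟨q, hq, hq0, hqT⟩ := mainTheorem2_general h𝒮 hUo hΨs hΨ h𝒜 hℬ
  obtain ⟨hopen, hdense, hsemialg⟩ := inter_ne_zero_of_mem_realPolyFunctions hUo hUs hq hq0
  exact ⟨_, inter_subset_left, hopen, hdense, hsemialg, fun t ht => hqT t ht.1 ht.2⟩
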